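/- A *tracial $W^*$-probability space* $(\mathcal A,\varphi)$ is a von Neumann algebra $\mathcal A$ with a (faithful) normal tracial state $\varphi$. Elements $a,b\in\mathcal A$ are *freely independent* if $\varphi(x_1\cdots x_n)=0$ whenever $n\ge 1$, the $x_k$ lie alternately in the unital $*$-subalgebras generated by $a$ and by $b$, and $\varphi(x_k)=0$ for all $k$. For a projection $e\in\mathcal A$, let $\mathcal S(e)$ be the set of all self-adjoint $y\in\mathcal A$ that are freely independent from $e$ and for which the distribution of $e+y$ is symmetric about $0$, i.e. $\varphi\big((e+y)^{2k+1}\big)=0$ for all $k\ge 0$. **Theorem.** Let $p\in[0,1]\setminus\{\tfrac12\}$. 1. Let $(\mathcal A,\varphi)$ be a tracial $W^*$-probability space and $e\in\mathcal A$ a projection with $\varphi(e)=p$. Then $\varphi(y^2)\ge p$ for every $y\in\mathcal S(e)$. If $y\in\mathcal A$ is self-adjoint, freely independent from $e$ and distributed as $-e$ (that is, $\varphi(y^n)=\varphi((-e)^n)$ for all $n\ge 0$), then $y\in\mathcal S(e)$ and $\varphi(y^2)=p$, so that $\min_{x\in\mathcal S(e)}\varphi(x^2)=p$. This part does not need $\varphi$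 to be faithful. 2. There are a tracial $W^*$-probability space $(\mathcal A,\varphi)$ with $\varphi$ faithful, a projection $e\in\mathcal A$ with $\varphi(e)=p$, and $y\in\mathcal S(e)$ distributed as $-e$. Hence the minimal value of $\varphi(y^2)$ over all such $y$ is exactly $p$, and it is attained. -/

import Mathlib

/-- The ultraweakly continuous functionals on a von Neumann algebra `M` acting on `H`:
`φ a = ∑ₙ ⟪ξₙ, a ηₙ⟫` for two square-summable sequences of vectors of `H`. -/
def IsNormalFunctional {H : Type*} [NormedAddCommGroup H] [InnerProductSpace ℂ H]
    [CompleteSpace H] (M : VonNeumannAlgebra H) (φ : M.toStarSubalgebra →ₗ[ℂ] ℂ) : Prop :=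
  ∃ ξ η : ℕ → H, (Summable fun n => ‖ξ n‖ ^ 2) ∧ (Summable fun n => ‖η n‖ ^ 2) ∧
    ∀ a : M.toStarSubalgebra, HasSum (fun n => inner ℂ (ξ n) ((a : H →L[ℂ] H) (η n))) (φ a)

/-- `φ` is a normal tracial state on the von Neumann algebra `M`. -/
structure IsNormalTracialState {H : Type*} [NormedAddCommGroup H] [InnerProductSpace ℂ H]
    [CompleteSpace H] (M : VonNeumannAlgebra H) (φ : M.toStarSubalgebra →ₗ[ℂ] ℂ) : Prop where
  map_one : φ 1 = 1
  re_nonneg : ∀ a, 0 ≤ (φ (star a * a)).re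
  im_eq_zero : ∀ a, (φ (star a * a)).im = 0
  tracial : ∀ a b, φ (a * b) = φ (b * a)
  normal : IsNormalFunctional M φ

/-- Faithfulness of a positive functional. -/
def IsFaithfulFunctional {A : Type*} [Ring A] [StarRing A] [Algebra ℂ A]
    (φ : A →ₗ[ℂ] ℂ) : Prop :=
  ∀ a : A, φ (star a * a) = 0 → a = 0

/-- Free independence of a family of unital `*`-subalgebras: every nonempty alternating product
of centred elements is centred. -/
def FreeSubalgebras {A : Type*} [Ring A] [StarRing A] [Algebra ℂ A] [StarModule ℂ A]
    (φ : A →ₗ[ℂ] ℂ) {ι : Type*} (B : ι → StarSubalgebra ℂ A) : Prop :=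
  ∀ (n : ℕ) (i : Fin (n + 1) → ι) (a : Fin (n + 1) → A),
    (∀ k : Fin n, i k.castSucc ≠ i k.succ) →
    (∀ k, a k ∈ B (i k)) → (∀ k, φ (a k) = 0) → φ (List.ofFn a).prod = 0

/-- Two elements are freely independent if the unital `*`-subalgebras that they generate are. -/
def FreelyIndependent {A : Type*} [Ring A] [StarRing A] [Algebra ℂ A] [StarModule ℂ A]
    (φ : A →ₗ[ℂ] ℂ) (a b : A) : Prop :=
  FreeSubalgebras φ ![StarAlgebra.adjoin ℂ {a}, StarAlgebra.adjoin ℂ {b}]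

/-- Self-adjoint elements have the same distribution if all their moments agree. -/
def SameDistribution {A : Type*} [Ring A] [Algebra ℂ A] (φ : A →ₗ[ℂ] ℂ) (a b : A) : Prop :=
  ∀ n : ℕ, φ (a ^ n) = φ (b ^ n)

/-- The self-adjoint `y`, freely independent from `e`, for which the distribution of `e + y` is
symmetric about `0`. -/
def freeSymmetrizers {A : Type*} [Ring A] [StarRing A] [Algebra ℂ A] [StarModule ℂ A]
    (φ : A →ₗ[ℂ] ℂ) (e : A) : Set A :=
  {y | IsSelfAdjoint y ∧ FreelyIndependent φ e y ∧ ∀ k : ℕ, φ ((e + y) ^ (2 * k + 1)) = 0}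

/-! Put `s = 2p - 1`, `f = e + y`, and let `V` be the variance of `y`. Since `φ y = -p`, the lower
bound says `V ≥ p(1 - p) = (1 - s²)/4`. Freeness gives subordination: if the Cauchy transform of `f`
takes the value `w` at `z`, then there are `ω₁`, `ω₂` with `ω₁ + ω₂ = z + 1/w` at which the Cauchy
transforms of `e` and of `y` also equal `w`. For a projection, `ω₁` is explicit up to a square root.
Symmetry of `f` makes `w = -ig` on `z = it`, so everything is expressed by two real functions of
`t`: `g` and the real part `A` of the square root.

Cauchy–Schwarz for the resolvent of `y` at `ω₂` is an inequality with constant `V`. For `e` at `ω₁`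
it is an equality with constant `(1 - s²)/4`, because the centred part of the algebra of `e` is
one-dimensional. Compare `x₁ = 1/g - Im ω₂` with `x₂ = 1/g - Im ω₁`. If `V < (1 - s²)/4`, then `x₁ <
x₂` for some large `t` and `x₁ = x₂` never happens, so `x₁ < x₂`, that is `A < tg`, for all `t > 0`.
At `t = s²` the two relations also force `|s|g < A`, which is absurd (`variance_lower_bound`).

Subordination comes from a factorization of `z - (a + b)` (`FreelyIndependent.map_resolvent_add`),
valid for small `w`; analyticity in `t` carries it to the whole half-axis
(`FreelyIndependent.le_map_sq_of_symmetric`). The same factorization makes the `R`-transform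
additive, so adding a free copy of `-e` produces an odd Cauchy transform
(`FreelyIndependent.map_odd_pow_add`).

Such a copy exists in the Hecke von Neumann algebra of the infinite dihedral group on `ℓ²(ℤ)`, whose
two generators, suitably shifted and scaled, are free projections of trace `p`
(`exists_free_projections`). For `p ∈ {0, 1}` scalars suffice. -/

section FreeSymmetrization

open Filter Topology Set

/-! ### The real-variable inequality along the imaginary axis -/

/-- The algebraic relations between `g`, `A` and `s` behind the square root
`A = Re √(1 - g² - 2isg)`. -/
lemma sqrt_re_bounds {s g A : ℝ} (hs1 : s ^ 2 < 1) (hg : 0 < g) (hA : 0 < A)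
    (h : A ^ 4 - s ^ 2 * g ^ 2 = A ^ 2 * (1 - g ^ 2)) :
    A < 1 ∧ s ^ 2 ≤ A ^ 2 ∧ 1 - g ^ 2 ≤ A ^ 2 := by
  have hg2 : 0 < g ^ 2 := by positivity
  have hA2 : 0 < A ^ 2 := by positivity
  -- So `A² - s²` and `1 - A²` have the same sign, and `s² < 1` excludes that both are nonpositive.
  have key : g ^ 2 * (A ^ 2 - s ^ 2) = A ^ 2 * (1 - A ^ 2) := by linear_combination h
  have h1 : A < 1 := by
    by_contra hc
    have hA1 : 1 ≤ A ^ 2 := by nlinarith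
    have : 0 < g ^ 2 * (A ^ 2 - s ^ 2) := by apply mul_pos hg2; linarith
    nlinarith
  have h2 : A ^ 2 < 1 := by nlinarith
  have h3 : s ^ 2 ≤ A ^ 2 := by
    by_contra hc
    have : g ^ 2 * (A ^ 2 - s ^ 2) < 0 := by apply mul_neg_of_pos_of_neg hg2; linarith
    nlinarith
  refine ⟨h1, h3, ?_⟩
  have : A ^ 2 * (1 - A ^ 2) ≤ A ^ 2 * g ^ 2 := by
    rw [← key]; nlinarith [sq_nonneg s]
  have := le_of_mul_le_mul_left this hA2
  linarith

/-- If `A` is the real part of `√(1 - g² - 2isg)` and the Cauchy–Schwarz inequality for the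
reciprocal Cauchy transform holds with variance `V` along the imaginary axis, then `V` is at
least the variance `(1 - s²) / 4` of the projection. -/
theorem variance_lower_bound {s V m : ℝ} (hs0 : s ≠ 0) (hs1 : s ^ 2 < 1) (hV0 : 0 ≤ V) {g A : ℝ → ℝ}
    (hg : ContinuousOn g (Ioi 0)) (hA : ContinuousOn A (Ioi 0))
    (gpos : ∀ t, 0 < t → 0 < g t) (Apos : ∀ t, 0 < t → 0 < A t)
    (glow : ∀ t, 0 < t → t ≤ (t ^ 2 + m) * g t) (gup : ∀ t, 0 < t → t * g t ≤ 1)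
    (hAg : ∀ t, 0 < t → A t ^ 4 - s ^ 2 * g t ^ 2 = A t ^ 2 * (1 - g t ^ 2))
    (hI : ∀ t, 0 < t → (t + (1 - A t) / (2 * g t)) *
      ((s / 2 * (1 - 1 / A t)) ^ 2 + ((1 + A t) / (2 * g t) - t) ^ 2) ≤
        V * ((1 + A t) / (2 * g t) - t)) :
    (1 - s ^ 2) / 4 ≤ V := by
  by_contra! hV
  have hb := fun t (ht : 0 < t) => sqrt_re_bounds hs1 (gpos t ht) (Apos t ht) (hAg t ht)
  -- The equality case of Cauchy–Schwarz, for the projection at `ω₁`: `(1 + A)/(2g)` is `Im ω₁`.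
  have hE : ∀ t, 0 < t → (1 + A t) / (2 * g t) *
      ((s / 2 * (1 - 1 / A t)) ^ 2 + ((1 - A t) / (2 * g t)) ^ 2) =
        (1 - s ^ 2) / 4 * ((1 - A t) / (2 * g t)) := by
    intro t ht
    have h1 := gpos t ht
    have h2 := Apos t ht
    field_simp
    linear_combination (-4 : ℝ) * (1 - A t) * (hAg t ht)
  have hd : ∀ t, 0 < t → 0 < (s / 2 * (1 - 1 / A t)) ^ 2 := by
    intro t ht
    have h2 := Apos t ht
    have : 1 < 1 / A t := by rw [lt_div_iff₀ h2]; linarith [(hb t ht).1]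
    have : s / 2 * (1 - 1 / A t) ≠ 0 := mul_ne_zero (by positivity) (by linarith)
    positivity
  have hx2 : ∀ t, 0 < t → 0 < (1 - A t) / (2 * g t) := fun t ht =>
    div_pos (by linarith [(hb t ht).1]) (by linarith [gpos t ht])
  have hb1 : ∀ t, 0 < t → 0 < (1 + A t) / (2 * g t) := fun t ht =>
    div_pos (by linarith [Apos t ht]) (by linarith [gpos t ht])
  -- With `x₁ = (1 + A)/(2g) - t` and `x₂ = (1 - A)/(2g)` this reads `x₁ - x₂ = A/g - t`.
  have hdiff : ∀ t, 0 < t → (1 + A t) / (2 * g t) - (1 - A t) / (2 * g t) = A t / g t := by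
    intro t ht
    have h1 := gpos t ht
    field_simp; ring
  -- the limits at infinity
  have tg : Tendsto (fun t => t * g t) atTop (𝓝 1) := by
    have h1 : Tendsto (fun t : ℝ => 1 - m / (t ^ 2 + m)) atTop (𝓝 (1 - 0)) := by
      refine tendsto_const_nhds.sub (tendsto_const_nhds.div_atTop ?_)
      exact tendsto_atTop_add_const_right _ _ (tendsto_pow_atTop (by norm_num))
    rw [sub_zero] at h1
    have hev : ∀ᶠ t : ℝ in atTop, 0 < t ^ 2 + m :=
      (tendsto_atTop_add_const_right _ _ (tendsto_pow_atTop (two_ne_zero))).eventually_gt_atTop 0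
    refine tendsto_of_tendsto_of_tendsto_of_le_of_le' h1 tendsto_const_nhds ?_ ?_
    · filter_upwards [hev, eventually_gt_atTop 0] with t ht ht0
      have := glow t ht0
      have h3 : 1 - m / (t ^ 2 + m) = t * t / (t ^ 2 + m) := by field_simp; ring
      rw [h3, div_le_iff₀ ht]; nlinarith
    · filter_upwards [eventually_gt_atTop 0] with t ht using gup t ht
  have g0 : Tendsto g atTop (𝓝 0) := by
    have : Tendsto (fun t : ℝ => t * g t * t⁻¹) atTop (𝓝 (1 * 0)) :=
      tg.mul tendsto_inv_atTop_zero
    rw [mul_zero] at this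
    refine this.congr' ?_
    filter_upwards [eventually_gt_atTop 0] with t ht
    field_simp
  have A1 : Tendsto A atTop (𝓝 1) := by
    have h1 : Tendsto (fun t => 1 - g t ^ 2) atTop (𝓝 (1 - 0 ^ 2)) :=
      tendsto_const_nhds.sub (g0.pow 2)
    rw [show (1 - (0 : ℝ) ^ 2) = 1 by norm_num] at h1
    refine tendsto_of_tendsto_of_tendsto_of_le_of_le' h1 tendsto_const_nhds ?_ ?_
    · filter_upwards [eventually_gt_atTop 0] with t ht
      have := hb t ht
      nlinarith [Apos t ht]
    · filter_upwards [eventually_gt_atTop 0] with t ht using (hb t ht).1.le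
  -- `t x₂` tends to the variance of the projection, whereas `x₂ ≤ x₁` would bound it by `V`.
  have hlim : Tendsto (fun t => t * ((1 - A t) / (2 * g t))) atTop (𝓝 ((1 - s ^ 2) / 4)) := by
    have h1 : Tendsto (fun t => t * g t * (1 - s ^ 2 / A t ^ 2) / (2 * (1 + A t))) atTop
        (𝓝 (1 * (1 - s ^ 2 / 1 ^ 2) / (2 * (1 + 1)))) :=
      (tg.mul (tendsto_const_nhds.sub (tendsto_const_nhds.div (A1.pow 2) (by norm_num)))).div
        (tendsto_const_nhds.mul (tendsto_const_nhds.add A1)) (by norm_num)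
    rw [show (1 * (1 - s ^ 2 / 1 ^ 2) / (2 * (1 + 1))) = (1 - s ^ 2) / 4 by ring] at h1
    refine h1.congr' ?_
    filter_upwards [eventually_gt_atTop 0] with t ht
    have h1 := gpos t ht
    have h2 := Apos t ht
    field_simp
    linear_combination hAg t ht
  -- the inequality at large `t`
  obtain ⟨t₁, ht₁V, ht₁⟩ :=
    ((hlim.eventually (lt_mem_nhds hV)).and (eventually_gt_atTop 0)).exists
  have hneg₁ : A t₁ / g t₁ < t₁ := by
    have hi := hI t₁ ht₁
    have h1 := hdiff t₁ ht₁
    have h2 := hd t₁ ht₁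
    have h3 := hx2 t₁ ht₁
    set x₁ := (1 + A t₁) / (2 * g t₁) - t₁ with hx₁
    set x₂ := (1 - A t₁) / (2 * g t₁)
    by_contra! hc
    have hx : x₂ ≤ x₁ := by linarith
    have hx₁pos : 0 < x₁ := by linarith
    have h5 : t₁ * x₁ ^ 2 ≤ V * x₁ := by
      refine le_trans ?_ hi
      apply mul_le_mul <;> first | positivity | linarith
    have h6 : t₁ * x₁ ≤ V := by
      refine le_of_mul_le_mul_right ?_ hx₁pos
      linarith
    have h7 : t₁ * x₂ ≤ t₁ * x₁ := by gcongr
    linarith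
  -- `A / g - t` never vanishes
  have hne : ∀ t, 0 < t → A t / g t ≠ t := by
    intro t ht hc
    have hi := hI t ht
    have he := hE t ht
    have h1 := hdiff t ht
    have h3 := hx2 t ht
    -- If `x₁ = x₂`, the left sides of `hI` and `hE` coincide, and cancelling `x₂` leaves `(1 -
    -- s²)/4 ≤ V`.
    have hx : (1 + A t) / (2 * g t) = t + (1 - A t) / (2 * g t) := by linarith
    rw [hx] at hi he
    rw [add_sub_cancel_left] at hi
    rw [he] at hi
    have := le_of_mul_le_mul_right hi h3
    linarith
  have hneg : ∀ t, 0 < t → A t / g t < t := by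
    intro t ht
    by_contra! hc
    have hcont : ContinuousOn (fun t => A t / g t - t) (Ioi 0) :=
      (hA.div hg (fun t ht => (gpos t ht).ne')).sub continuousOn_id
    have := isPreconnected_Ioi.intermediate_value (a := t₁) (b := t) ht₁ ht hcont
    obtain ⟨u, hu, hu0⟩ := this (show (0 : ℝ) ∈ Icc _ _ from ⟨by linarith, by linarith⟩)
    exact hne u hu (by linarith)
  -- contradiction at `t = s²`
  have hT : 0 < s ^ 2 := by positivity
  have hi := hI _ hT
  have he := hE _ hT
  have h1 := hdiff _ hT
  have h2 := hd _ hT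
  have h3 := hx2 _ hT
  have h4 := hb1 _ hT
  have h5 := hneg _ hT
  obtain ⟨b₁, b₂, -⟩ := hb _ hT
  have hgT := gpos _ hT
  have hAT := Apos _ hT
  -- Because of this factor `x₂`, the bound `d² < x₂²` will say exactly `|s|g < A`.
  have hdef : s / 2 * (1 - 1 / A (s ^ 2)) =
      -((1 - A (s ^ 2)) / (2 * g (s ^ 2))) * (s * g (s ^ 2) / A (s ^ 2)) := by
    field_simp
    ring
  set G := g (s ^ 2)
  set B := A (s ^ 2)
  set d := s / 2 * (1 - 1 / B)
  set b := (1 + B) / (2 * G)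
  set x₁ := b - s ^ 2 with hx₁
  set x₂ := (1 - B) / (2 * G)
  have hlt : x₁ < x₂ := by linarith
  have hx₁pos : 0 < x₁ := by
    have hp : 0 < (s ^ 2 + x₂) * (d ^ 2 + x₁ ^ 2) := by positivity
    by_contra! hc
    have hx1 : -x₁ ≥ 0 := by linarith
    have h7 : s ^ 2 + x₂ > 0 := by positivity
    nlinarith
  -- Cross-multiply the inequality for `y` by `x₂` and the identity for `e` by `x₁`, using `b = s² +
  -- x₁ < s² + x₂`; then cancel `x₂ - x₁ > 0`.
  have hd2 : d ^ 2 < x₁ * x₂ := by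
    have h8 : b * (d ^ 2 + x₁ ^ 2) * x₂ < b * (d ^ 2 + x₂ ^ 2) * x₁ := by
      calc b * (d ^ 2 + x₁ ^ 2) * x₂ ≤ (s ^ 2 + x₂) * (d ^ 2 + x₁ ^ 2) * x₂ := by
            gcongr; linarith
        _ ≤ V * x₁ * x₂ := by gcongr
        _ < (1 - s ^ 2) / 4 * x₁ * x₂ := by gcongr
        _ = b * (d ^ 2 + x₂ ^ 2) * x₁ := by rw [he]; ring
    have h9 : (d ^ 2 + x₁ ^ 2) * x₂ < (d ^ 2 + x₂ ^ 2) * x₁ := by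
      refine lt_of_mul_lt_mul_left ?_ h4.le
      linarith
    have h10 : d ^ 2 * (x₂ - x₁) < x₁ * x₂ * (x₂ - x₁) := by linarith
    exact lt_of_mul_lt_mul_right h10 (by linarith)
  have hd3 : d ^ 2 < x₂ ^ 2 := by nlinarith
  rw [hdef, mul_pow, neg_sq] at hd3
  have h11 : (s * G / B) ^ 2 < 1 := by
    by_contra! hc
    nlinarith [sq_nonneg x₂]
  have h12 : s ^ 2 * G ^ 2 < B ^ 2 := by
    rw [div_pow, div_lt_one (by positivity)] at h11
    linarith
  -- The choice `t = s²` pays off here: `s⁴ ≤ s²`, so `B < s²G` contradicts `s²G² < B²`.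
  have h13 : B < s ^ 2 * G := by rwa [div_lt_iff₀ hgT] at h5
  have h14 : B ^ 2 < (s ^ 2 * G) ^ 2 := by gcongr
  have h15 : (s ^ 2 * G) ^ 2 ≤ s ^ 2 * G ^ 2 := by
    have : s ^ 2 * (s ^ 2 * G ^ 2) ≤ 1 * (s ^ 2 * G ^ 2) := by gcongr
    linarith
  linarith

/-! ### Alternating words -/

/-- The alternating product `x * y * x * ⋯` with `n` factors. -/
def altProd {A : Type*} [Monoid A] : ℕ → A → A → A
  | 0, _, _ => 1
  | n + 1, x, y => x * altProd n y x

lemma altProd_succ {A : Type*} [Monoid A] (n : ℕ) (x y : A) :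
    altProd (n + 1) x y = x * altProd n y x := rfl

lemma prod_ofFn_alternating {A : Type*} [Monoid A] (n : ℕ) (x y : A) :
    (List.ofFn fun k : Fin n => if Even (k : ℕ) then x else y).prod = altProd n x y := by
  induction n generalizing x y with
  | zero => simp [altProd]
  | succ n ih =>
    rw [List.ofFn_succ, List.prod_cons, altProd_succ, ← ih y x]
    congr 2
    · congr 1
      funext k
      by_cases h : Even (k : ℕ) <;> simp [Nat.even_add_one, h]

lemma mul_pow_eq_altProd {A : Type*} [Monoid A] (n : ℕ) (x y : A) :
    (x * y) ^ n = altProd (2 * n) x y := by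
  induction n with
  | zero => simp [altProd]
  | succ n ih => rw [pow_succ', ih, mul_add, mul_one, altProd_succ, altProd_succ, mul_assoc]

lemma mul_pow_mul_eq_altProd {A : Type*} [Monoid A] (n : ℕ) (x y : A) :
    (x * y) ^ n * x = altProd (2 * n + 1) x y := by
  induction n with
  | zero => simp [altProd]
  | succ n ih =>
    rw [pow_succ', mul_assoc, ih, show 2 * (n + 1) + 1 = 2 * n + 1 + 1 + 1 by ring,
      altProd_succ (2 * n + 1 + 1), altProd_succ (2 * n + 1), mul_assoc]

lemma FreelyIndependent.symm {A : Type*} [Ring A] [StarRing A] [Algebra ℂ A] [StarModule ℂ A]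
    {φ : A →ₗ[ℂ] ℂ} {a b : A} (h : FreelyIndependent φ a b) : FreelyIndependent φ b a := by
  intro n i x hi hx h0
  refine h n (fun k => (i k).rev) x (fun k => fun hk => hi k (Fin.rev_injective hk))
    (fun k => ?_) h0
  have := hx k
  revert this
  generalize i k = j
  fin_cases j <;> exact id

lemma hasSum_inverse_one_sub {A : Type*} [NormedRing A] [CompleteSpace A] {a : A} (h : ‖a‖ < 1) :
    HasSum (fun n : ℕ => a ^ n) (Ring.inverse (1 - a)) := by
  rw [NormedRing.inverse_one_sub a h]
  exact (summable_geometric_of_norm_lt_one h).hasSum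

/-! ### Cauchy transforms near infinity and their compositional inverses -/

section Banach

variable {A : Type*} [NormedRing A] [NormedAlgebra ℂ A]

/-- `ζ ↦ φ (ζ (1 - ζ a)⁻¹)`, the Cauchy transform of `a` in the coordinate `ζ = 1 / z`. -/
noncomputable def momentTransform (φ : A →L[ℂ] ℂ) (a : A) (ζ : ℂ) : ℂ :=
  ζ * φ (Ring.inverse (1 - ζ • a))

@[simp] lemma momentTransform_zero (φ : A →L[ℂ] ℂ) (a : A) : momentTransform φ a 0 = 0 := by
  simp [momentTransform]

lemma momentTransform_inv (φ : A →L[ℂ] ℂ) (a : A) {z : ℂ} (hz : z ≠ 0) :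
    momentTransform φ a z⁻¹ = φ (resolvent a z) := by
  have h := spectrum.units_smul_resolvent_self (r := Units.mk0 z hz) (a := a)
  have h2 : Ring.inverse (1 - z⁻¹ • a) = z • resolvent a z := by
    have : resolvent (z⁻¹ • a) (1 : ℂ) = Ring.inverse (1 - z⁻¹ • a) := by simp [resolvent]
    rw [← this]
    exact h.symm
  rw [momentTransform, h2, map_smul, smul_eq_mul, inv_mul_cancel_left₀ hz]

lemma momentTransform_neg (φ : A →L[ℂ] ℂ) (a : A) (ζ : ℂ) :
    momentTransform φ (-a) ζ = -momentTransform φ a (-ζ) := by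
  simp [momentTransform]

lemma eventually_norm_smul_lt_one (a : A) : ∀ᶠ ζ : ℂ in 𝓝 0, ‖ζ • a‖ < 1 := by
  have : Tendsto (fun ζ : ℂ => ‖ζ • a‖) (𝓝 0) (𝓝 ‖(0 : ℂ) • a‖) :=
    ((continuous_id.smul continuous_const).norm).tendsto 0
  refine this.eventually (gt_mem_nhds ?_)
  simp

variable [CompleteSpace A]

lemma eventually_hasSum_moments (φ : A →L[ℂ] ℂ) (a : A) : ∀ᶠ ζ : ℂ in 𝓝 0,
    HasSum (fun n : ℕ => ζ ^ n * φ (a ^ n)) (φ (Ring.inverse (1 - ζ • a))) := by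
  filter_upwards [eventually_norm_smul_lt_one a] with ζ hζ
  simpa [smul_pow] using (hasSum_inverse_one_sub hζ).mapL φ

lemma analyticAt_inverse_one_sub_smul (a : A) :
    AnalyticAt ℂ (fun ζ : ℂ => Ring.inverse (1 - ζ • a)) 0 :=
  (spectrum.hasFPowerSeriesOnBall_inverse_one_sub_smul ℂ a).analyticAt

lemma hasStrictDerivAt_momentTransform {φ : A →L[ℂ] ℂ} (h1 : φ 1 = 1) (a : A) :
    HasStrictDerivAt (momentTransform φ a) 1 0 := by
  have h : AnalyticAt ℂ (fun ζ : ℂ => φ (Ring.inverse (1 - ζ • a))) 0 :=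
    (φ.analyticAt _).comp (analyticAt_inverse_one_sub_smul a)
  have := (hasStrictDerivAt_id (0 : ℂ)).mul h.hasStrictDerivAt
  simp only [id, one_mul, zero_mul, add_zero, zero_smul, sub_zero, Ring.inverse_one, h1] at this
  exact this

/-- `L` is the compositional inverse near `0` of a function `h` with `h 0 = 0`, `h' 0 = 1`. -/
structure IsLocalCompInverse (h L : ℂ → ℂ) : Prop where
  right : ∀ᶠ w in 𝓝 0, h (L w) = w
  left : ∀ᶠ ζ in 𝓝 0, L (h ζ) = ζ
  deriv : HasDerivAt L 1 0
  map_zero : L 0 = 0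

lemma exists_isLocalCompInverse {φ : A →L[ℂ] ℂ} (h1 : φ 1 = 1) (a : A) :
    ∃ L, IsLocalCompInverse (momentTransform φ a) L := by
  have h := hasStrictDerivAt_momentTransform h1 a
  refine ⟨h.localInverse _ _ _ one_ne_zero, ?_, h.eventually_left_inverse one_ne_zero, ?_, ?_⟩
  · simpa using h.eventually_right_inverse one_ne_zero
  · simpa using (h.to_localInverse one_ne_zero).hasDerivAt
  · simpa using (h.eventually_left_inverse one_ne_zero).self_of_nhds

namespace IsLocalCompInverse

variable {h L : ℂ → ℂ}

lemma tendsto (H : IsLocalCompInverse h L) : Tendsto L (𝓝 0) (𝓝 0) := by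
  simpa [H.map_zero] using H.deriv.continuousAt.tendsto

lemma eventually_ne (H : IsLocalCompInverse h L) (h0 : h 0 = 0) :
    ∀ᶠ w in 𝓝[≠] 0, L w ≠ 0 := by
  filter_upwards [H.right.filter_mono nhdsWithin_le_nhds, self_mem_nhdsWithin] with w hw hw0 hL
  rw [hL, h0] at hw
  exact hw0 hw.symm

lemma tendsto_div (H : IsLocalCompInverse h L) :
    Tendsto (fun w => w * (L w)⁻¹) (𝓝[≠] 0) (𝓝 1) := by
  have := (hasDerivAt_iff_tendsto_slope.1 H.deriv).inv₀ one_ne_zero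
  simpa [slope_def_field, H.map_zero, div_eq_mul_inv] using this

/-- A local solution `M w → 0` of `h (M w) = w` is the compositional inverse. -/
lemma eventually_eq (H : IsLocalCompInverse h L) {ι : Type*} {l : Filter ι} {M w : ι → ℂ}
    (hM : Tendsto M l (𝓝 0)) (hw : ∀ᶠ i in l, h (M i) = w i) : ∀ᶠ i in l, M i = L (w i) := by
  filter_upwards [hM.eventually H.left, hw] with i h1 h2
  rw [← h2, h1]

end IsLocalCompInverse

/-- Points `ζ` at which the Neumann series converges and the normalized resolvent is close
to `1`. -/
def NormalizedResolventSmall (φ : A →L[ℂ] ℂ) (a : A) (ζ : ℂ) : Prop :=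
  ‖ζ • a‖ < 1 ∧ φ (Ring.inverse (1 - ζ • a)) ≠ 0 ∧
    ‖(φ (Ring.inverse (1 - ζ • a)))⁻¹ • Ring.inverse (1 - ζ • a) - 1‖ < 1

lemma eventually_normalizedResolventSmall {φ : A →L[ℂ] ℂ} (h1 : φ 1 = 1) (a : A) :
    ∀ᶠ ζ in 𝓝 0, NormalizedResolventSmall φ a ζ := by
  have hR : ContinuousAt (fun ζ : ℂ => Ring.inverse (1 - ζ • a)) 0 :=
    (analyticAt_inverse_one_sub_smul a).continuousAt
  have hφ : ContinuousAt (fun ζ : ℂ => φ (Ring.inverse (1 - ζ • a))) 0 :=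
    φ.continuous.continuousAt.comp hR
  have hφ0 : φ (Ring.inverse (1 - (0 : ℂ) • a)) ≠ 0 := by simp [h1]
  have hN : ContinuousAt (fun ζ : ℂ =>
      ‖(φ (Ring.inverse (1 - ζ • a)))⁻¹ • Ring.inverse (1 - ζ • a) - 1‖) 0 :=
    (((hφ.inv₀ hφ0).smul hR).sub continuousAt_const).norm
  refine (eventually_norm_smul_lt_one a).and ((hφ.eventually_ne hφ0).and ?_)
  refine hN.tendsto.eventually (gt_mem_nhds ?_)
  simp [h1]

end Banach

/-! ### Freeness and additivity of the `R`-transform -/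

section Free

variable {A : Type*} [NormedRing A] [NormedAlgebra ℂ A] [StarRing A] [StarModule ℂ A]

/-- Freeness of subalgebras passes to their closures. -/
lemma FreeSubalgebras.map_prod_of_mem_closure {φ : A →L[ℂ] ℂ} (h1 : φ 1 = 1) {ι : Type*}
    {B : ι → StarSubalgebra ℂ A} (h : FreeSubalgebras (φ : A →ₗ[ℂ] ℂ) B) {n : ℕ}
    {i : Fin (n + 1) → ι} {x : Fin (n + 1) → A} (hi : ∀ k : Fin n, i k.castSucc ≠ i k.succ)
    (hx : ∀ k, x k ∈ closure (B (i k) : Set A)) (h0 : ∀ k, φ (x k) = 0) :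
    φ (List.ofFn x).prod = 0 := by
  -- Subtracting `φ y • 1` recentres an approximant without leaving the subalgebra.
  have hcl : ∀ k, x k ∈ closure {y : A | y ∈ B (i k) ∧ φ y = 0} := by
    intro k
    have hc : Continuous fun y : A => y - φ y • (1 : A) := by fun_prop
    have := map_mem_closure hc (hx k) (t := {y : A | y ∈ B (i k) ∧ φ y = 0}) (by
      intro y hy
      refine ⟨sub_mem hy (SMulMemClass.smul_mem _ (one_mem _)), ?_⟩
      simp [h1])
    simpa [h0 k] using this
  have hmem : x ∈ closure (Set.pi univ fun k => {y : A | y ∈ B (i k) ∧ φ y = 0}) := by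
    rw [closure_pi_set]
    exact fun k _ => hcl k
  have hcont : Continuous fun x : Fin (n + 1) → A => φ (List.ofFn x).prod := by
    simp only [List.ofFn_eq_map]
    exact φ.continuous.comp (continuous_list_prod _ fun k _ => continuous_apply k)
  have hclosed : IsClosed {x : Fin (n + 1) → A | φ (List.ofFn x).prod = 0} :=
    isClosed_singleton.preimage hcont
  refine closure_minimal ?_ hclosed hmem
  intro z hz
  exact h n i z hi (fun k => (hz k trivial).1) (fun k => (hz k trivial).2)

lemma FreelyIndependent.map_altProd {φ : A →L[ℂ] ℂ} (h1 : φ 1 = 1) {a b x y : A}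
    (h : FreelyIndependent (φ : A →ₗ[ℂ] ℂ) a b)
    (hx : x ∈ closure (StarAlgebra.adjoin ℂ {a} : Set A))
    (hy : y ∈ closure (StarAlgebra.adjoin ℂ {b} : Set A))
    (hx0 : φ x = 0) (hy0 : φ y = 0) {n : ℕ} (hn : n ≠ 0) : φ (altProd n x y) = 0 := by
  obtain ⟨n, rfl⟩ := Nat.exists_eq_succ_of_ne_zero hn
  rw [Nat.succ_eq_add_one, ← prod_ofFn_alternating]
  refine FreeSubalgebras.map_prod_of_mem_closure h1 h
    (i := fun k => if Even (k : ℕ) then 0 else 1) (fun k => ?_) (fun k => ?_) (fun k => ?_)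
  · by_cases hk : Even (k : ℕ) <;> simp [Nat.even_add_one, hk]
  · by_cases hk : Even (k : ℕ) <;> simp only [hk, if_true, if_false]
    · exact hx
    · exact hy
  · by_cases hk : Even (k : ℕ) <;> simp [hk, hx0, hy0]

variable [CompleteSpace A]

/-- Each term of the Neumann series expands into alternating words in the centred elements `x`, `y`.
The outer factors are arranged so that only the empty word, from `n = 0`, survives under `φ`. -/
lemma FreelyIndependent.map_inverse_word {φ : A →L[ℂ] ℂ} (h1 : φ 1 = 1) {a b x y : A}
    (h : FreelyIndependent (φ : A →ₗ[ℂ] ℂ) a b)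
    (hx : x ∈ closure (StarAlgebra.adjoin ℂ {a} : Set A))
    (hy : y ∈ closure (StarAlgebra.adjoin ℂ {b} : Set A))
    (hx0 : φ x = 0) (hy0 : φ y = 0) (hxy : ‖x * y‖ < 1) :
    φ ((1 + y) * Ring.inverse (1 - x * y) * (1 + x)) = 1 := by
  have hs := (((hasSum_inverse_one_sub hxy).mul_left (1 + y)).mul_right (1 + x)).mapL φ
  refine hs.unique ?_
  convert hasSum_ite_eq (0 : ℕ) (1 : ℂ) using 2 with n
  have hxy0 : ∀ m, m ≠ 0 → φ (altProd m x y) = 0 := fun m => h.map_altProd h1 hx hy hx0 hy0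
  have hyx0 : ∀ m, m ≠ 0 → φ (altProd m y x) = 0 := fun m => h.symm.map_altProd h1 hy hx hy0 hx0
  have hexp : (1 + y) * (x * y) ^ n * (1 + x) = altProd (2 * n) x y + altProd (2 * n + 1) x y
      + altProd (2 * n + 1) y x + altProd (2 * n + 2) y x := by
    rw [altProd_succ (2 * n) y x, altProd_succ (2 * n + 1) y x, ← mul_pow_eq_altProd,
      ← mul_pow_mul_eq_altProd]
    noncomm_ring
  rw [hexp]
  simp only [map_add, hxy0 (2 * n + 1) (by omega), hyx0 (2 * n + 1) (by omega),
    hyx0 (2 * n + 2) (by omega), add_zero]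
  split_ifs with hn
  · simp [hn, altProd, h1]
  · exact hxy0 _ (by omega)

lemma inverse_one_sub_mem_closure_adjoin {a : A} {ζ : ℂ} (h : ‖ζ • a‖ < 1) :
    Ring.inverse (1 - ζ • a) ∈ closure (StarAlgebra.adjoin ℂ {a} : Set A) := by
  refine mem_closure_of_tendsto (hasSum_inverse_one_sub h).tendsto_sum_nat
    (Eventually.of_forall fun n => ?_)
  exact sum_mem fun k _ => pow_mem (SMulMemClass.smul_mem _
    (StarAlgebra.self_mem_adjoin_singleton ℂ a)) _

/-- The resolvent of a sum of free elements in terms of the resolvents of the summands. -/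
lemma FreelyIndependent.map_resolvent_add {φ : A →L[ℂ] ℂ} (h1 : φ 1 = 1) {a b : A}
    (h : FreelyIndependent (φ : A →ₗ[ℂ] ℂ) a b) {ζ₁ ζ₂ w : ℂ} (hw : w ≠ 0)
    (ha : NormalizedResolventSmall φ a ζ₁) (hb : NormalizedResolventSmall φ b ζ₂)
    (hwa : momentTransform φ a ζ₁ = w) (hwb : momentTransform φ b ζ₂ = w) :
    φ (resolvent (a + b) (ζ₁⁻¹ + ζ₂⁻¹ - w⁻¹)) = w := by
  -- the normalized resolvents `1 + x` and `1 + y`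
  have aux : ∀ {c : A} {ζ : ℂ}, NormalizedResolventSmall φ c ζ → momentTransform φ c ζ = w →
      ∃ x : A, x ∈ closure (StarAlgebra.adjoin ℂ {c} : Set A) ∧ φ x = 0 ∧ ‖x‖ < 1 ∧
        (algebraMap ℂ A ζ⁻¹ - c) * (w • (1 + x)) = 1 ∧
        (w • (1 + x)) * (algebraMap ℂ A ζ⁻¹ - c) = 1 := by
    rintro c ζ ⟨hn, hne, hlt⟩ hζ
    set R := Ring.inverse (1 - ζ • c) with hR
    have hζ0 : ζ ≠ 0 := by
      rintro rfl
      exact hw (by rw [← hζ, momentTransform_zero])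
    have hu := isUnit_one_sub_of_norm_lt_one hn
    have hfac : algebraMap ℂ A ζ⁻¹ - c = ζ⁻¹ • (1 - ζ • c) := by
      rw [smul_sub, smul_smul, inv_mul_cancel₀ hζ0, one_smul, Algebra.algebraMap_eq_smul_one]
    have hwR : w • (φ R)⁻¹ • R = ζ • R := by
      rw [← hζ, momentTransform, ← hR, smul_smul, mul_assoc, mul_inv_cancel₀ hne, mul_one]
    refine ⟨(φ R)⁻¹ • R - 1, ?_, ?_, hlt, ?_, ?_⟩
    · have hmem := inverse_one_sub_mem_closure_adjoin hn
      exact map_mem_closure (f := fun r : A => (φ R)⁻¹ • r - 1) (by fun_prop) hmem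
        fun r hr => sub_mem (SMulMemClass.smul_mem _ hr) (one_mem _)
    · simp [h1, hne]
    · rw [add_sub_cancel, hwR, hfac, smul_mul_smul_comm, inv_mul_cancel₀ hζ0, one_smul,
        Ring.mul_inverse_cancel _ hu]
    · rw [add_sub_cancel, hwR, hfac, smul_mul_smul_comm, mul_inv_cancel₀ hζ0, one_smul,
        Ring.inverse_mul_cancel _ hu]
  obtain ⟨x, hxm, hx0, hxn, hPx, hxP⟩ := aux ha hwa
  obtain ⟨y, hym, hy0, hyn, hQy, hyQ⟩ := aux hb hwb
  have hxy : ‖x * y‖ < 1 := (norm_mul_le _ _).trans_lt (by nlinarith [norm_nonneg x, norm_nonneg y])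
  have hu := isUnit_one_sub_of_norm_lt_one hxy
  set P := algebraMap ℂ A ζ₁⁻¹ - a with hP
  set Q := algebraMap ℂ A ζ₂⁻¹ - b with hQ
  set N := Ring.inverse (1 - x * y)
  have hNl : N * (1 - x * y) = 1 := Ring.inverse_mul_cancel _ hu
  have hNr : (1 - x * y) * N = 1 := Ring.mul_inverse_cancel _ hu
  -- The left side is `P + Q - w⁻¹ = P (P⁻¹ + Q⁻¹ - w⁻¹ P⁻¹ Q⁻¹) Q`, where `P⁻¹ = w(1 + x)` and `Q⁻¹
  -- = w(1 + y)`.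
  have hsum : algebraMap ℂ A (ζ₁⁻¹ + ζ₂⁻¹ - w⁻¹) - (a + b) = w • (P * (1 - x * y) * Q) := by
    have e1 : P * (w • (1 + x)) * (w • (1 + y)) * Q = 1 := by
      rw [hPx, one_mul, hyQ]
    have e2 : w • (P * (1 - x * y) * Q) =
        P * ((w • (1 + y)) * Q) + (P * (w • (1 + x))) * Q
          - w⁻¹ • (P * (w • (1 + x)) * (w • (1 + y)) * Q) := by
      simp only [mul_smul_comm, smul_mul_assoc, smul_smul]
      rw [← mul_assoc w⁻¹, inv_mul_cancel₀ hw, one_mul, ← smul_add, ← smul_sub]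
      congr 1
      noncomm_ring
    rw [e2, e1, hyQ, hPx, mul_one, one_mul, hP, hQ, map_sub, map_add,
      Algebra.algebraMap_eq_smul_one (w⁻¹)]
    abel
  have hinv : resolvent (a + b) (ζ₁⁻¹ + ζ₂⁻¹ - w⁻¹) = w • ((1 + y) * N * (1 + x)) := by
    have hl : (w • ((1 + y) * N * (1 + x))) * (w • (P * (1 - x * y) * Q)) = 1 := by
      calc _ = (w • (1 + y)) * (N * (((w • (1 + x)) * P) * (1 - x * y))) * Q := by
            simp only [mul_smul_comm, smul_mul_assoc, mul_assoc]
        _ = 1 := by rw [hxP, one_mul, hNl, mul_one, hyQ]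
    have hr : (w • (P * (1 - x * y) * Q)) * (w • ((1 + y) * N * (1 + x))) = 1 := by
      calc _ = P * ((1 - x * y) * ((Q * (w • (1 + y))) * N)) * (w • (1 + x)) := by
            simp only [mul_smul_comm, smul_mul_assoc, mul_assoc]
        _ = 1 := by rw [hQy, one_mul, hNr, mul_one, hPx]
    rw [resolvent, hsum]
    exact Ring.inverse_unit ⟨_, _, hr, hl⟩
  rw [hinv, map_smul, h.map_inverse_word h1 hxm hym hx0 hy0 hxy, smul_eq_mul, mul_one]

/-- Additivity of the `R`-transform: `z ↦ 1 / z`-coordinates of the inverse Cauchy transforms. -/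
theorem FreelyIndependent.eventually_inverse_add {φ : A →L[ℂ] ℂ} (h1 : φ 1 = 1) {a b : A}
    (h : FreelyIndependent (φ : A →ₗ[ℂ] ℂ) a b) {La Lb Lf : ℂ → ℂ}
    (ha : IsLocalCompInverse (momentTransform φ a) La)
    (hb : IsLocalCompInverse (momentTransform φ b) Lb)
    (hf : IsLocalCompInverse (momentTransform φ (a + b)) Lf) :
    ∀ᶠ w in 𝓝[≠] 0, (Lf w)⁻¹ = (La w)⁻¹ + (Lb w)⁻¹ - w⁻¹ := by
  have hle : 𝓝[≠] (0 : ℂ) ≤ 𝓝 0 := nhdsWithin_le_nhds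
  have hlim : Tendsto (fun w => w * (La w)⁻¹ + w * (Lb w)⁻¹ - 1) (𝓝[≠] 0) (𝓝 1) := by
    simpa using (ha.tendsto_div.add hb.tendsto_div).sub (tendsto_const_nhds (x := (1 : ℂ)))
  -- This is the candidate for `Lf w`. As it tends to `0`, solving the equation for `a + b`
  -- identifies it with the local inverse.
  have hM : Tendsto (fun w => ((La w)⁻¹ + (Lb w)⁻¹ - w⁻¹)⁻¹) (𝓝[≠] 0) (𝓝 0) := by
    have h2 : Tendsto (fun w : ℂ => w * (w * (La w)⁻¹ + w * (Lb w)⁻¹ - 1)⁻¹) (𝓝[≠] 0)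
        (𝓝 (0 * 1⁻¹)) := (tendsto_id.mono_left hle).mul (hlim.inv₀ one_ne_zero)
    rw [zero_mul] at h2
    refine h2.congr' ?_
    filter_upwards [self_mem_nhdsWithin] with w hw
    have hw : w ≠ 0 := hw
    have : w * (La w)⁻¹ + w * (Lb w)⁻¹ - 1 = w * ((La w)⁻¹ + (Lb w)⁻¹ - w⁻¹) := by
      rw [mul_sub, mul_add, mul_inv_cancel₀ hw]
    rw [this, mul_inv, mul_inv_cancel_left₀ hw]
  have hmain : ∀ᶠ w in 𝓝[≠] 0,
      momentTransform φ (a + b) ((La w)⁻¹ + (Lb w)⁻¹ - w⁻¹)⁻¹ = w := by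
    filter_upwards [hle (ha.tendsto.eventually (eventually_normalizedResolventSmall h1 a)),
      hle (hb.tendsto.eventually (eventually_normalizedResolventSmall h1 b)),
      hle ha.right, hle hb.right, self_mem_nhdsWithin,
      hlim.eventually_ne one_ne_zero] with w h2 h3 h4 h5 h6 h7
    have hw : w ≠ 0 := h6
    have hz : (La w)⁻¹ + (Lb w)⁻¹ - w⁻¹ ≠ 0 := by
      intro h0
      apply h7
      have : w * (La w)⁻¹ + w * (Lb w)⁻¹ - 1 = w * ((La w)⁻¹ + (Lb w)⁻¹ - w⁻¹) := by
        rw [mul_sub, mul_add, mul_inv_cancel₀ hw]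
      rw [this, h0, mul_zero]
    rw [momentTransform_inv _ _ hz]
    exact h.map_resolvent_add h1 hw h2 h3 h4 h5
  filter_upwards [hf.eventually_eq hM hmain] with w hw
  rw [← hw, inv_inv]

end Free

/-! ### Odd moments and odd transforms -/

section Symmetry

lemma coeff_eq_zero_of_eventually_hasSum_zero {c : ℕ → ℂ}
    (h : ∀ᶠ z : ℂ in 𝓝 0, HasSum (fun n => z ^ n * c n) 0) (n : ℕ) : c n = 0 := by
  have hp : HasFPowerSeriesAt (0 : ℂ → ℂ) (FormalMultilinearSeries.ofScalars ℂ c) 0 := by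
    rw [hasFPowerSeriesAt_iff]
    filter_upwards [h] with z hz
    simpa using hz
  rw [← FormalMultilinearSeries.coeff_ofScalars (𝕜 := ℂ) (p := c) (n := n), hp.eq_zero]
  rfl

variable {A : Type*} [NormedRing A] [NormedAlgebra ℂ A] [CompleteSpace A]

lemma eventually_momentTransform_odd (φ : A →L[ℂ] ℂ) {a : A}
    (h : ∀ k : ℕ, φ (a ^ (2 * k + 1)) = 0) :
    ∀ᶠ ζ in 𝓝 0, momentTransform φ a (-ζ) = -momentTransform φ a ζ := by
  have hneg : Tendsto (fun ζ : ℂ => -ζ) (𝓝 0) (𝓝 0) := by simpa using tendsto_neg (0 : ℂ)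
  filter_upwards [eventually_hasSum_moments φ a, hneg.eventually (eventually_hasSum_moments φ a)]
    with ζ h1 h2
  have : (fun n : ℕ => (-ζ) ^ n * φ (a ^ n)) = fun n => ζ ^ n * φ (a ^ n) := by
    funext n
    rcases Nat.even_or_odd' n with ⟨k, rfl | rfl⟩
    · rw [(even_two_mul k).neg_pow]
    · rw [h k, mul_zero, mul_zero]
  rw [this] at h2
  rw [momentTransform, momentTransform, h2.unique h1, neg_mul]

lemma map_odd_pow_of_momentTransform_odd (φ : A →L[ℂ] ℂ) {a : A}
    (h : ∀ᶠ ζ in 𝓝 0, momentTransform φ a (-ζ) = -momentTransform φ a ζ) (k : ℕ) :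
    φ (a ^ (2 * k + 1)) = 0 := by
  have hneg : Tendsto (fun ζ : ℂ => -ζ) (𝓝 0) (𝓝 0) := by simpa using tendsto_neg (0 : ℂ)
  -- The factor `1 - (-1)^n` removes the even moments and doubles the odd ones.
  have key : ∀ᶠ z : ℂ in 𝓝 0,
      HasSum (fun n => z ^ n * ((1 - (-1) ^ n) * φ (a ^ n))) 0 := by
    filter_upwards [eventually_hasSum_moments φ a,
      hneg.eventually (eventually_hasSum_moments φ a), h] with ζ h1 h2 h3
    have h4 : φ (Ring.inverse (1 - ζ • a)) - φ (Ring.inverse (1 - (-ζ) • a)) = 0 := by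
      by_cases hζ : ζ = 0
      · simp [hζ]
      · rw [momentTransform, momentTransform, neg_mul, neg_inj] at h3
        rw [mul_left_cancel₀ hζ h3, sub_self]
    rw [← h4]
    refine (h1.sub h2).congr_fun ?_
    intro n
    rw [neg_pow ζ n]
    ring
  have := coeff_eq_zero_of_eventually_hasSum_zero key (2 * k + 1)
  rw [pow_succ (-1 : ℂ), pow_mul] at this
  norm_num at this
  exact this

/-- If `b` is free from `a` and distributed as `-a`, then `a + b` is symmetric. -/
theorem FreelyIndependent.map_odd_pow_add [StarRing A] [StarModule ℂ A] {φ : A →L[ℂ] ℂ}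
    (h1 : φ 1 = 1) {a b : A} (h : FreelyIndependent (φ : A →ₗ[ℂ] ℂ) a b)
    (hd : SameDistribution (φ : A →ₗ[ℂ] ℂ) b (-a)) (k : ℕ) : φ ((a + b) ^ (2 * k + 1)) = 0 := by
  obtain ⟨La, ha⟩ := exists_isLocalCompInverse h1 a
  obtain ⟨Lb, hb⟩ := exists_isLocalCompInverse h1 b
  obtain ⟨Lf, hf⟩ := exists_isLocalCompInverse h1 (a + b)
  have hneg : Tendsto (fun ζ : ℂ => -ζ) (𝓝 0) (𝓝 0) := by simpa using tendsto_neg (0 : ℂ)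
  have hnegne : Tendsto (fun ζ : ℂ => -ζ) (𝓝[≠] 0) (𝓝[≠] 0) := by
    refine tendsto_nhdsWithin_iff.2 ⟨hneg.mono_left nhdsWithin_le_nhds, ?_⟩
    filter_upwards [self_mem_nhdsWithin] with ζ hζ
    exact neg_ne_zero.2 hζ
  have hH : ∀ᶠ ζ in 𝓝 0, momentTransform φ b ζ = -momentTransform φ a (-ζ) := by
    filter_upwards [eventually_hasSum_moments φ b, eventually_hasSum_moments φ (-a)] with ζ h2 h3
    have : (fun n : ℕ => ζ ^ n * φ (b ^ n)) = fun n => ζ ^ n * φ ((-a) ^ n) := by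
      funext n
      exact congrArg _ (hd n)
    rw [this] at h2
    rw [← momentTransform_neg, momentTransform, momentTransform, h2.unique h3]
  -- `-La (-w)` inverts the transform of `-a`, hence that of `b`. The sum `(La w)⁻¹ + (Lb w)⁻¹ -
  -- w⁻¹` is therefore odd in `w`.
  have hM : Tendsto (fun w => -La (-w)) (𝓝 0) (𝓝 0) := by
    simpa using (ha.tendsto.comp hneg).neg
  have hLb : ∀ᶠ w in 𝓝 0, -La (-w) = Lb w := by
    refine hb.eventually_eq hM ?_
    filter_upwards [hM.eventually hH, hneg.eventually ha.right] with w h2 h3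
    rw [h2, neg_neg, h3, neg_neg]
  have hLf : ∀ᶠ w in 𝓝 0, Lf (-w) = -Lf w := by
    have h2 := h.eventually_inverse_add h1 ha hb hf
    have h3 : ∀ᶠ w in 𝓝[≠] 0, Lf (-w) = -Lf w := by
      filter_upwards [h2, hnegne.eventually h2, nhdsWithin_le_nhds hLb,
        nhdsWithin_le_nhds (hneg.eventually hLb)] with w e1 e2 e3 e4
      rw [neg_neg] at e4
      rw [← inv_inj, inv_neg, e1, e2, ← e3, ← e4]
      simp only [inv_neg]
      ring
    rw [eventually_nhdsWithin_iff] at h3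
    filter_upwards [h3] with w hw
    by_cases hw0 : w = 0
    · simp [hw0, hf.map_zero]
    · exact hw hw0
  refine map_odd_pow_of_momentTransform_odd φ ?_ k
  have hHf : Tendsto (momentTransform φ (a + b)) (𝓝 0) (𝓝 0) := by
    simpa using (hasStrictDerivAt_momentTransform h1 (a + b)).hasDerivAt.continuousAt.tendsto
  filter_upwards [hf.left, hHf.eventually hLf, (hneg.comp hHf).eventually hf.right]
    with ζ h2 h3 h4
  rw [h2] at h3
  simp only [Function.comp_apply] at h4
  rw [h3] at h4
  exact h4

end Symmetry

/-! ### States and Cauchy–Schwarz for resolvents -/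

section State

variable {A : Type*} [CStarAlgebra A]

/-- Bounded positive unital functionals. -/
structure IsStateFunctional (φ : A →L[ℂ] ℂ) : Prop where
  map_one : φ 1 = 1
  re_nonneg : ∀ a, 0 ≤ (φ (star a * a)).re
  im_eq_zero : ∀ a, (φ (star a * a)).im = 0

namespace IsStateFunctional

variable {φ : A →L[ℂ] ℂ}

/-- Polarization: the values at `star x * x` are real for `x = 1 + a` and `x = 1 + i a`, which
compares the imaginary and the real parts respectively. -/
lemma map_star (h : IsStateFunctional φ)
    (a : A) : φ (star a) = star (φ a) := by
  have h1 := h.im_eq_zero (1 + a)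
  have h2 := h.im_eq_zero (1 + Complex.I • a)
  have h3 := h.im_eq_zero a
  have e1 : star (1 + a) * (1 + a) = 1 + a + star a + star a * a := by
    rw [star_add, star_one]; noncomm_ring
  have e2 : star (1 + Complex.I • a) * (1 + Complex.I • a) =
      1 + Complex.I • a - Complex.I • star a + star a * a := by
    rw [star_add, star_one, star_smul, add_mul, one_mul, mul_add, mul_one, smul_mul_smul_comm]
    simp
    abel
  rw [e1] at h1
  rw [e2] at h2
  simp [h.map_one, h3] at h1 h2
  apply Complex.ext
  · simp; linarith
  · simp; linarith

lemma norm_map_star_mul_sq_le (h : IsStateFunctional φ)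
    (a b : A) :
    ‖φ (star a * b)‖ ^ 2 ≤ (φ (star a * a)).re * (φ (star b * b)).re := by
  let c : PreInnerProductSpace.Core ℂ A :=
    { inner := fun a b => φ (star a * b)
      conj_inner_symm := fun a b => by
        have := h.map_star (star b * a)
        rw [star_mul, star_star] at this
        exact this.symm
      re_inner_nonneg := fun a => h.re_nonneg a
      add_left := fun a b c => by simp [add_mul]
      smul_left := fun a b r => by simp }
  have := @InnerProductSpace.Core.inner_mul_inner_self_le ℂ A _ _ _ c a b
  have hs : ‖φ (star b * a)‖ = ‖φ (star a * b)‖ := by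
    have h2 := h.map_star (star a * b)
    rw [star_mul, star_star] at h2
    rw [h2, norm_star]
  change ‖φ (star a * b)‖ * ‖φ (star b * a)‖ ≤ (φ (star a * a)).re * (φ (star b * b)).re at this
  rw [hs] at this
  rwa [pow_two]

end IsStateFunctional

lemma IsSelfAdjoint.isUnit_algebraMap_sub {y : A} (hy : IsSelfAdjoint y) {ω : ℂ}
    (hω : ω.im ≠ 0) : IsUnit (algebraMap ℂ A ω - y) := by
  by_contra hc
  have h1 : ω ∈ spectrum ℂ y := hc
  have h2 := hy.mem_spectrum_eq_re h1
  apply hω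
  rw [h2, Complex.ofReal_im]

lemma IsSelfAdjoint.star_resolvent {y : A} (hy : IsSelfAdjoint y) (ω : ℂ) :
    star (resolvent y ω) = resolvent y (star ω) := by
  rw [resolvent, resolvent, ← Ring.inverse_star, star_sub, hy.star_eq, algebraMap_star_comm]

lemma IsSelfAdjoint.analyticAt_map_resolvent {y : A} (hy : IsSelfAdjoint y) (φ : A →L[ℂ] ℂ)
    {ω : ℂ} (hω : ω.im ≠ 0) : AnalyticAt ℂ (fun z => φ (resolvent y z)) ω := by
  have hd : DifferentiableOn ℂ (fun z => φ (resolvent y z)) (resolventSet ℂ y) := fun z hz =>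
    (φ.differentiableAt.comp z
      (spectrum.hasDerivAt_resolvent_const_left hz).differentiableAt).differentiableWithinAt
  exact hd.analyticAt ((spectrum.isOpen_resolventSet y).mem_nhds (hy.isUnit_algebraMap_sub hω))

namespace IsStateFunctional

variable {φ : A →L[ℂ] ℂ}

/-- Apply `φ` to the resolvent identity `(ω - ω̄) r* r = r* - r`. -/
lemma map_star_resolvent_mul_resolvent (h : IsStateFunctional φ) {y : A} (hy : IsSelfAdjoint y)
    {ω : ℂ} (hω : ω.im ≠ 0) :
    (φ (star (resolvent y ω) * resolvent y ω)).re = -(φ (resolvent y ω)).im / ω.im := by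
  have hu := hy.isUnit_algebraMap_sub hω
  set r := resolvent y ω with hr
  have e1 : (algebraMap ℂ A ω - y) * r = 1 := Ring.mul_inverse_cancel _ hu
  have e2 : star r * (algebraMap ℂ A (star ω) - y) = 1 := by
    have := congrArg star e1
    rwa [star_mul, star_sub, hy.star_eq, star_one, ← algebraMap_star_comm] at this
  have e3 : (ω - star ω) • (star r * r) = star r - r := by
    calc (ω - star ω) • (star r * r)
        = star r * ((algebraMap ℂ A ω - y) * r) - (star r * (algebraMap ℂ A (star ω) - y)) * r := by
          simp only [Algebra.algebraMap_eq_smul_one, sub_mul, mul_sub, smul_mul_assoc, one_mul,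
            mul_smul_comm, mul_one, sub_smul, mul_assoc]
          abel
      _ = star r - r := by rw [e1, e2, mul_one, one_mul]
  have e4 := congrArg φ e3
  rw [map_smul, map_sub, h.map_star, smul_eq_mul] at e4
  have e5 := congrArg Complex.im e4
  simp [h.im_eq_zero] at e5
  rw [eq_div_iff hω]
  linarith

/-- The Cauchy–Schwarz inequality for the reciprocal Cauchy transform. -/
lemma normSq_one_sub_mul_le (h : IsStateFunctional φ) {y : A} (hy : IsSelfAdjoint y)
    {m : ℝ} (hm : φ y = m) {ω : ℂ} (hω : ω.im ≠ 0) :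
    ‖1 - (ω - m) * φ (resolvent y ω)‖ ^ 2 ≤ ((φ (y ^ 2)).re - m ^ 2) *
      (-(φ (resolvent y ω)).im / ω.im - ‖φ (resolvent y ω)‖ ^ 2) := by
  have hu := hy.isUnit_algebraMap_sub hω
  have hrr := h.map_star_resolvent_mul_resolvent hy hω
  set r := resolvent y ω with hr
  have e1 : (algebraMap ℂ A ω - y) * r = 1 := Ring.mul_inverse_cancel _ hu
  have e2 : y * r = ω • r - 1 := by
    rw [sub_mul, Algebra.algebraMap_eq_smul_one, smul_mul_assoc, one_mul] at e1
    rw [← e1]; abel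
  set G := φ r
  -- Both elements are centred, so that the variance of `y`, and not its second moment, is the
  -- constant.
  have hcs := h.norm_map_star_mul_sq_le (y - (m : ℂ) • 1) (r - G • 1)
  have hst : star (y - (m : ℂ) • (1 : A)) = y - (m : ℂ) • 1 := by
    simp [hy.star_eq]
  rw [hst] at hcs
  have f1 : φ ((y - (m : ℂ) • 1) * (r - G • 1)) = -(1 - (ω - m) * G) := by
    have : (y - (m : ℂ) • 1) * (r - G • 1) = ω • r - 1 - G • y - (m : ℂ) • r + (m * G) • 1 := by
      rw [← e2]
      simp only [sub_mul, mul_sub, smul_mul_assoc, one_mul, mul_smul_comm, mul_one, smul_sub,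
        smul_smul]
      abel_nf
      simp [mul_comm]
    rw [this]
    simp only [map_add, map_sub, map_smul, smul_eq_mul, h.map_one, hm]
    ring
  have f2 : (φ ((y - (m : ℂ) • 1) * (y - (m : ℂ) • 1))).re = (φ (y ^ 2)).re - m ^ 2 := by
    have : (y - (m : ℂ) • (1 : A)) * (y - (m : ℂ) • 1) =
        y ^ 2 - (m : ℂ) • y - (m : ℂ) • y + ((m : ℂ) * m) • 1 := by
      simp only [sub_mul, mul_sub, smul_mul_assoc, one_mul, mul_smul_comm, mul_one, smul_sub,
        smul_smul, pow_two]
      abel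
    rw [this]
    simp only [map_add, map_sub, map_smul, smul_eq_mul, h.map_one, hm]
    simp
    ring
  have f3 : (φ (star (r - G • 1) * (r - G • 1))).re = -G.im / ω.im - ‖G‖ ^ 2 := by
    have : star (r - G • (1 : A)) * (r - G • 1) =
        star r * r - G • star r - star G • r + (star G * G) • 1 := by
      rw [star_sub, star_smul, star_one]
      simp only [sub_mul, mul_sub, smul_mul_assoc, one_mul, mul_smul_comm, mul_one, smul_sub,
        smul_smul]
      abel_nf
      simp [mul_comm]
    rw [this]
    simp only [map_add, map_sub, map_smul, smul_eq_mul, h.map_one, h.map_star]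
    rw [Complex.add_re, Complex.sub_re, Complex.sub_re, hrr, ← Complex.normSq_eq_norm_sq,
      Complex.normSq_apply]
    simp [G]
  rwa [f1, f2, f3, norm_neg] at hcs

end IsStateFunctional

end State

/-! ### The Cauchy transform of a projection -/

/-- The square root in the inverse Cauchy transform of a projection of trace `(1 + s) / 2`. -/
noncomputable def projSqrt (s : ℝ) (w : ℂ) : ℂ := (1 + 2 * s * w + w ^ 2) ^ (2⁻¹ : ℂ)

lemma projSqrt_sq (s : ℝ) (w : ℂ) : projSqrt s w ^ 2 = 1 + 2 * s * w + w ^ 2 := by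
  have := Complex.cpow_nat_inv_pow (1 + 2 * s * w + w ^ 2) (n := 2) two_ne_zero
  simpa only [projSqrt, Nat.cast_ofNat] using this

lemma analyticAt_projSqrt {s : ℝ} {w : ℂ} (h : 1 + 2 * s * w + w ^ 2 ∈ Complex.slitPlane) :
    AnalyticAt ℂ (projSqrt s) w :=
  AnalyticAt.cpow (by fun_prop) analyticAt_const h

/-- The imaginary part is `-2sg ≠ 0`. This is where `p ≠ 1/2` keeps the principal root analytic on
the whole negative imaginary axis. -/
lemma mem_slitPlane_of_imaginary {s g : ℝ} (hs : s ≠ 0) (hg : 0 < g) :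
    1 + 2 * s * (-Complex.I * g) + (-Complex.I * g) ^ 2 ∈ Complex.slitPlane := by
  refine Complex.mem_slitPlane_iff.2 (Or.inr ?_)
  simp [pow_two, hs, hg.ne']

lemma projSqrt_imaginary {s g : ℝ} (hs : s ≠ 0) (hg : 0 < g) :
    0 < (projSqrt s (-Complex.I * g)).re ∧
    (projSqrt s (-Complex.I * g)).re * (projSqrt s (-Complex.I * g)).im = -(s * g) ∧
    (projSqrt s (-Complex.I * g)).re ^ 4 - s ^ 2 * g ^ 2 =
      (projSqrt s (-Complex.I * g)).re ^ 2 * (1 - g ^ 2) := by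
  have hm := mem_slitPlane_of_imaginary hs hg
  have hsq := projSqrt_sq s (-Complex.I * g)
  have hre : 0 < (projSqrt s (-Complex.I * g)).re := by
    rw [projSqrt, Complex.cpow_inv_two_re]
    apply Real.sqrt_pos.2
    set X := 1 + 2 * (s : ℂ) * (-Complex.I * g) + (-Complex.I * g) ^ 2
    have h1 : |X.re| < ‖X‖ := by
      rw [Complex.abs_re_lt_norm]
      simp [X, pow_two, hs, hg.ne']
    have := neg_abs_le X.re
    linarith
  set S := projSqrt s (-Complex.I * g)
  have h1 := congrArg Complex.re hsq
  have h2 := congrArg Complex.im hsq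
  simp [pow_two] at h1 h2
  have h3 : S.re * S.im = -(s * g) := by linarith
  refine ⟨hre, h3, ?_⟩
  have h4 : s ^ 2 * g ^ 2 = (S.re * S.im) ^ 2 := by rw [h3]; ring
  rw [h4]
  linear_combination S.re ^ 2 * h1

section

variable {A : Type*} [CStarAlgebra A]

lemma IsStarProjection.map_resolvent {φ : A →L[ℂ] ℂ} (h1 : φ 1 = 1) {e : A}
    (he : IsStarProjection e) {ω : ℂ} (h0 : ω ≠ 0) (hω : ω ≠ 1) :
    φ (resolvent e ω) = ω⁻¹ * (1 - φ e) + (ω - 1)⁻¹ * φ e := by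
  have hω' : ω - 1 ≠ 0 := sub_ne_zero.2 hω
  have hee : e * e = e := he.isIdempotentElem
  have e1 : (algebraMap ℂ A ω - e) * (ω⁻¹ • (1 - e) + (ω - 1)⁻¹ • e) = 1 := by
    have : (algebraMap ℂ A ω - e) * (ω⁻¹ • (1 - e) + (ω - 1)⁻¹ • e) =
        (ω⁻¹ * ω) • (1 - e) + ((ω - 1)⁻¹ * (ω - 1)) • e := by
      simp only [Algebra.algebraMap_eq_smul_one, sub_mul, mul_sub, mul_add, smul_mul_assoc,
        one_mul, mul_smul_comm, mul_one, smul_sub, smul_smul, sub_smul, hee]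
      abel
    rw [this, inv_mul_cancel₀ h0, inv_mul_cancel₀ hω']
    simp
  have e2 : (ω⁻¹ • (1 - e) + (ω - 1)⁻¹ • e) * (algebraMap ℂ A ω - e) = 1 := by
    refine Eq.trans (Commute.eq ?_) e1
    refine Commute.sub_right (Algebra.commutes ω _).symm ?_
    exact (((Commute.one_left e).sub_left (Commute.refl e)).smul_left _).add_left
      ((Commute.refl e).smul_left _)
  have : resolvent e ω = ω⁻¹ • (1 - e) + (ω - 1)⁻¹ • e := Ring.inverse_unit ⟨_, _, e1, e2⟩
  rw [this]
  simp [h1]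

/-- The point at which the Cauchy transform of a projection takes the value `w`. -/
noncomputable def projInvCauchy (s : ℝ) (w : ℂ) : ℂ := (w + 1 + projSqrt s w) / (2 * w)

lemma IsStarProjection.map_resolvent_projInvCauchy {φ : A →L[ℂ] ℂ} (h1 : φ 1 = 1) {e : A}
    (he : IsStarProjection e) {p : ℝ} (hp : φ e = p) {w : ℂ} (hw : w ≠ 0)
    (h0 : projInvCauchy (2 * p - 1) w ≠ 0) (hω : projInvCauchy (2 * p - 1) w ≠ 1) :
    φ (resolvent e (projInvCauchy (2 * p - 1) w)) = w := by
  rw [he.map_resolvent h1 h0 hω, hp]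
  have hω' := sub_ne_zero.2 hω
  have hdef : 2 * w * projInvCauchy (2 * p - 1) w = w + 1 + projSqrt (2 * p - 1) w := by
    rw [projInvCauchy]; field_simp
  have hsq := projSqrt_sq (2 * p - 1) w
  set ω := projInvCauchy (2 * p - 1) w
  -- The second factor is `(1 - p)/ω + p/(ω - 1) = w` with denominators cleared.
  have hquad : w * (w * ω ^ 2 - (w + 1) * ω + (1 - p)) = 0 := by
    have : projSqrt (2 * p - 1) w = 2 * w * ω - w - 1 := by linear_combination -hdef
    rw [this] at hsq
    push_cast at hsq
    linear_combination hsq / 4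
  have hquad := (mul_eq_zero.1 hquad).resolve_left hw
  field_simp
  linear_combination -hquad

namespace IsStateFunctional

variable {φ : A →L[ℂ] ℂ}

/-- Cauchy–Schwarz applied to `1 = φ ((it - f) r)`, with `φ (r* r) = -Im φ(r) / t`. It gives both
the positivity of `g` and the lower half of `t g → 1`. -/
lemma le_mul_neg_im_resolvent (h : IsStateFunctional φ) {f : A} (hf : IsSelfAdjoint f)
    {t : ℝ} (ht : 0 < t) :
    t ≤ (t ^ 2 + (φ (f ^ 2)).re) * -(φ (resolvent f (Complex.I * t))).im := by
  have him : (Complex.I * t).im ≠ 0 := by simpa using ht.ne'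
  have hu := hf.isUnit_algebraMap_sub him
  have hrr := h.map_star_resolvent_mul_resolvent hf him
  set r := resolvent f (Complex.I * t) with hr
  have e1 : (algebraMap ℂ A (Complex.I * t) - f) * r = 1 := Ring.mul_inverse_cancel _ hu
  have hcs := h.norm_map_star_mul_sq_le (star (algebraMap ℂ A (Complex.I * t) - f)) r
  rw [star_star, e1, h.map_one, hrr] at hcs
  have e2 : (algebraMap ℂ A (Complex.I * t) - f) * star (algebraMap ℂ A (Complex.I * t) - f) =
      ((t : ℂ) ^ 2) • 1 + f ^ 2 := by
    rw [star_sub, hf.star_eq, ← algebraMap_star_comm]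
    simp only [Algebra.algebraMap_eq_smul_one, sub_mul, mul_sub, smul_mul_assoc, one_mul,
      mul_smul_comm, mul_one, smul_sub, smul_smul, pow_two]
    have : Complex.I * (t : ℂ) * star (Complex.I * (t : ℂ)) = t * t := by
      simp only [star_mul', Complex.star_def, Complex.conj_I, Complex.conj_ofReal]
      linear_combination -(t : ℂ) ^ 2 * Complex.I_sq
    have h2 : star (Complex.I * (t : ℂ)) = -(Complex.I * t) := by simp
    rw [mul_comm] at this
    rw [this, h2, neg_smul]
    abel
  rw [e2] at hcs
  simp [h.map_one, ← Complex.ofReal_pow] at hcs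
  rw [mul_div_assoc', le_div_iff₀ ht] at hcs
  linarith

lemma mul_neg_im_resolvent_le_one (h : IsStateFunctional φ) {f : A} (hf : IsSelfAdjoint f)
    {t : ℝ} (ht : 0 < t)
    (hpos : 0 < -(φ (resolvent f (Complex.I * t))).im) :
    t * -(φ (resolvent f (Complex.I * t))).im ≤ 1 := by
  have him : (Complex.I * t).im ≠ 0 := by simpa using ht.ne'
  have hrr := h.map_star_resolvent_mul_resolvent hf him
  set r := resolvent f (Complex.I * t) with hr
  have hcs := h.norm_map_star_mul_sq_le 1 r
  rw [hrr] at hcs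
  simp only [star_one, one_mul, h.map_one, Complex.one_re] at hcs
  have h2 : (-(φ r).im) ^ 2 ≤ ‖φ r‖ ^ 2 := by
    rw [neg_sq, ← sq_abs]
    gcongr
    exact Complex.abs_im_le_norm _
  have h3 := h2.trans hcs
  simp at h3
  rw [le_div_iff₀ ht] at h3
  nlinarith

end IsStateFunctional

lemma IsSelfAdjoint.analyticAt_neg_im_resolvent {f : A} (hf : IsSelfAdjoint f) (φ : A →L[ℂ] ℂ)
    {t : ℝ} (ht : 0 < t) :
    AnalyticAt ℝ (fun t : ℝ => -(φ (resolvent f (Complex.I * t))).im) t := by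
  have him : (Complex.I * t).im ≠ 0 := by simpa using ht.ne'
  have h1 : AnalyticAt ℝ (fun z => φ (resolvent f z)) (Complex.I * t) :=
    (hf.analyticAt_map_resolvent φ him).restrictScalars
  have h2 : AnalyticAt ℝ (fun t : ℝ => Complex.I * (t : ℂ)) t :=
    analyticAt_const.mul (Complex.ofRealCLM.analyticAt t)
  have h3 : AnalyticAt ℝ (fun t : ℝ => φ (resolvent f (Complex.I * t))) t :=
    AnalyticAt.comp (f := fun t : ℝ => Complex.I * (t : ℂ)) h1 h2
  exact ((Complex.imCLM.analyticAt _).comp h3).neg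

end

/-! ### Subordination along the imaginary axis and the lower bound -/

lemma projInvCauchy_imaginary (s : ℝ) {g : ℝ} (hg : 0 < g) :
    projInvCauchy s (-Complex.I * g) =
      1 / 2 + (1 + projSqrt s (-Complex.I * g)) * Complex.I * ((2 * g)⁻¹ : ℝ) := by
  have hg' : (g : ℂ) ≠ 0 := by exact_mod_cast hg.ne'
  have hI := Complex.I_ne_zero
  rw [projInvCauchy]
  push_cast
  field_simp
  linear_combination (-(1 + projSqrt s (-(Complex.I * g)))) * Complex.I_sq

lemma projInvCauchy_imaginary_im (s : ℝ) {g : ℝ} (hg : 0 < g) :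
    (projInvCauchy s (-Complex.I * g)).im =
      (1 + (projSqrt s (-Complex.I * g)).re) / (2 * g) := by
  rw [projInvCauchy_imaginary s hg, Complex.add_im, Complex.im_mul_ofReal]
  simp [div_eq_mul_inv]

lemma inv_neg_I_mul (g : ℝ) : (-Complex.I * (g : ℂ))⁻¹ = Complex.I * (g⁻¹ : ℝ) := by
  rw [mul_inv, inv_neg, Complex.inv_I, neg_neg, Complex.ofReal_inv]

/-- The subordination point for the second summand, in terms of the value `w` of the Cauchy
transform of the sum at `z`. -/
noncomputable def projSubordination (s : ℝ) (z w : ℂ) : ℂ := z + w⁻¹ - projInvCauchy s w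

lemma projSubordination_im (s t : ℝ) {g : ℝ} (hg : 0 < g) :
    (projSubordination s (Complex.I * t) (-Complex.I * g)).im =
      t + (1 - (projSqrt s (-Complex.I * g)).re) / (2 * g) := by
  rw [projSubordination, Complex.sub_im, projInvCauchy_imaginary_im s hg, Complex.add_im,
    inv_neg_I_mul]
  simp
  field_simp
  ring

/-- The real part involves the imaginary part of the square root, which `Re · Im = -sg` trades for
its real part. -/
lemma projSubordination_re {s : ℝ} (hs : s ≠ 0) (t : ℝ) {g : ℝ} (hg : 0 < g) :
    (projSubordination s (Complex.I * t) (-Complex.I * g)).re + (1 + s) / 2 =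
      s / 2 * (1 - 1 / (projSqrt s (-Complex.I * g)).re) := by
  obtain ⟨h1, h2, -⟩ := projSqrt_imaginary hs hg
  rw [projSubordination, Complex.sub_re, projInvCauchy_imaginary s hg, Complex.add_re,
    inv_neg_I_mul, Complex.add_re, Complex.re_mul_ofReal]
  set S := projSqrt s (-Complex.I * g)
  simp
  field_simp
  linear_combination h2

lemma tendsto_inv_I_mul_atTop :
    Tendsto (fun t : ℝ => (Complex.I * (t : ℂ))⁻¹) atTop (𝓝 0) := by
  rw [tendsto_zero_iff_norm_tendsto_zero]
  have h : Tendsto (fun t : ℝ => |t|⁻¹) atTop (𝓝 0) :=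
    tendsto_inv_atTop_zero.comp tendsto_abs_atTop_atTop
  simpa using h

section

variable {A : Type*} [CStarAlgebra A]

/-- For a self-adjoint element with symmetric distribution, the Cauchy transform is imaginary high
up on the imaginary axis. -/
lemma IsStateFunctional.eventually_map_resolvent_imaginary {φ : A →L[ℂ] ℂ}
    (h : IsStateFunctional φ) {f : A} (hf : IsSelfAdjoint f)
    (hodd : ∀ k : ℕ, φ (f ^ (2 * k + 1)) = 0) :
    ∀ᶠ t : ℝ in atTop, φ (resolvent f (Complex.I * t)) =
      -Complex.I * (-(φ (resolvent f (Complex.I * t))).im : ℝ) := by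
  have hζ := tendsto_inv_I_mul_atTop
  filter_upwards [hζ.eventually (eventually_momentTransform_odd φ hodd), eventually_gt_atTop 0]
    with t h1 ht
  have hz : Complex.I * (t : ℂ) ≠ 0 := mul_ne_zero Complex.I_ne_zero (by exact_mod_cast ht.ne')
  rw [← inv_neg, momentTransform_inv _ _ (neg_ne_zero.2 hz), momentTransform_inv _ _ hz] at h1
  -- At `-it` oddness gives the negative of the value and self-adjointness its conjugate, so the
  -- real part vanishes.
  have h2 : -(Complex.I * (t : ℂ)) = star (Complex.I * (t : ℂ)) := by simp
  rw [h2, ← hf.star_resolvent, h.map_star] at h1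
  have h3 := congrArg Complex.re h1
  simp at h3
  apply Complex.ext
  · simp; linarith
  · simp

/-- The Cauchy transform of the second summand at the subordination point, high up on the
imaginary axis. -/
lemma FreelyIndependent.eventually_map_resolvent_projSubordination {φ : A →L[ℂ] ℂ}
    (h : IsStateFunctional φ) {e y : A} (he : IsStarProjection e) (hy : IsSelfAdjoint y)
    {p : ℝ} (hp : φ e = p) (hp2 : 2 * p - 1 ≠ 0)
    (hfree : FreelyIndependent (φ : A →ₗ[ℂ] ℂ) e y)
    (hodd : ∀ k : ℕ, φ ((e + y) ^ (2 * k + 1)) = 0) {g : ℝ → ℝ}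
    (hg : ∀ t, g t = -(φ (resolvent (e + y) (Complex.I * t))).im)
    (gpos : ∀ t, 0 < t → 0 < g t) :
    ∀ᶠ t : ℝ in atTop, φ (resolvent y (projSubordination (2 * p - 1) (Complex.I * t)
      (-Complex.I * g t))) = -Complex.I * g t := by
  have hf : IsSelfAdjoint (e + y) := he.isSelfAdjoint.add hy
  obtain ⟨Le, hLe⟩ := exists_isLocalCompInverse h.map_one e
  obtain ⟨Ly, hLy⟩ := exists_isLocalCompInverse h.map_one y
  obtain ⟨Lf, hLf⟩ := exists_isLocalCompInverse h.map_one (e + y)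
  have hζ := tendsto_inv_I_mul_atTop
  have hIt : ∀ t : ℝ, 0 < t → Complex.I * (t : ℂ) ≠ 0 := fun t ht =>
    mul_ne_zero Complex.I_ne_zero (by exact_mod_cast ht.ne')
  have hHf : ∀ᶠ t : ℝ in atTop,
      momentTransform φ (e + y) (Complex.I * (t : ℂ))⁻¹ = -Complex.I * g t := by
    filter_upwards [h.eventually_map_resolvent_imaginary hf hodd, eventually_gt_atTop 0]
      with t h1 ht
    rw [momentTransform_inv _ _ (hIt t ht), hg t]
    exact h1
  have hw0 : ∀ t, 0 < t → -Complex.I * (g t : ℂ) ≠ 0 := fun t ht =>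
    mul_ne_zero (neg_ne_zero.2 Complex.I_ne_zero) (by exact_mod_cast (gpos t ht).ne')
  have hw : Tendsto (fun t => -Complex.I * (g t : ℂ)) atTop (𝓝 0) := by
    have h1 : Tendsto (momentTransform φ (e + y)) (𝓝 0) (𝓝 0) := by
      simpa using
        (hasStrictDerivAt_momentTransform h.map_one (e + y)).hasDerivAt.continuousAt.tendsto
    exact (h1.comp hζ).congr' hHf
  have hw' : Tendsto (fun t => -Complex.I * (g t : ℂ)) atTop (𝓝[≠] 0) := by
    refine tendsto_nhdsWithin_iff.2 ⟨hw, ?_⟩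
    filter_upwards [eventually_gt_atTop 0] with t ht using hw0 t ht
  -- The principal root is near `1` for small `w`, so `ω₁` goes to infinity; this selects the branch
  -- given by the local inverse `Le`.
  have hω1 : Tendsto (fun t => (projInvCauchy (2 * p - 1) (-Complex.I * g t))⁻¹) atTop (𝓝 0) := by
    have hc : Tendsto (projSqrt (2 * p - 1)) (𝓝 0) (𝓝 (projSqrt (2 * p - 1) 0)) :=
      (analyticAt_projSqrt (by simp)).continuousAt
    have h0 : projSqrt (2 * p - 1) 0 = 1 := by simp [projSqrt]
    rw [h0] at hc
    have h2 : Tendsto (fun w : ℂ => 2 * w / (w + 1 + projSqrt (2 * p - 1) w)) (𝓝 0)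
        (𝓝 (2 * 0 / (0 + 1 + 1))) :=
      (tendsto_const_nhds.mul tendsto_id).div ((tendsto_id.add tendsto_const_nhds).add hc)
        (by norm_num)
    rw [mul_zero, zero_div] at h2
    refine (h2.comp hw).congr fun t => ?_
    simp only [Function.comp_apply, projInvCauchy, inv_div]
  have hHe : ∀ᶠ t : ℝ in atTop, momentTransform φ e
      (projInvCauchy (2 * p - 1) (-Complex.I * g t))⁻¹ = -Complex.I * g t := by
    filter_upwards [eventually_gt_atTop 0] with t ht
    have him : 0 < (projInvCauchy (2 * p - 1) (-Complex.I * g t)).im := by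
      rw [projInvCauchy_imaginary_im _ (gpos t ht)]
      have := (projSqrt_imaginary hp2 (gpos t ht)).1
      have := gpos t ht
      positivity
    have h0 : projInvCauchy (2 * p - 1) (-Complex.I * g t) ≠ 0 := by
      intro h0; rw [h0] at him; simp at him
    have h1 : projInvCauchy (2 * p - 1) (-Complex.I * g t) ≠ 1 := by
      intro h0; rw [h0] at him; simp at him
    rw [momentTransform_inv _ _ h0]
    exact he.map_resolvent_projInvCauchy h.map_one hp (hw0 t ht) h0 h1
  filter_upwards [hLf.eventually_eq hζ hHf, hLe.eventually_eq hω1 hHe,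
    hw'.eventually (hfree.eventually_inverse_add h.map_one hLe hLy hLf),
    hw'.eventually (hLy.eventually_ne (momentTransform_zero φ y)), hw.eventually hLy.right]
    with t h1 h2 h3 h4 h5
  have h6 : projSubordination (2 * p - 1) (Complex.I * t) (-Complex.I * g t) =
      (Ly (-Complex.I * g t))⁻¹ := by
    rw [← h1, ← h2, inv_inv, inv_inv] at h3
    rw [projSubordination, h3]
    ring
  rw [h6, ← momentTransform_inv _ _ (inv_ne_zero h4), inv_inv, h5]

/-- A self-adjoint element free from a projection of trace `p ≠ 1/2` which symmetrizes it has
second moment at least `p`. -/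
theorem FreelyIndependent.le_map_sq_of_symmetric {φ : A →L[ℂ] ℂ} (h : IsStateFunctional φ)
    {e y : A} (he : IsStarProjection e) (hy : IsSelfAdjoint y) {p : ℝ} (hp01 : p ∈ Icc (0 : ℝ) 1)
    (hp : φ e = p) (hp2 : p ≠ 1 / 2) (hfree : FreelyIndependent (φ : A →ₗ[ℂ] ℂ) e y)
    (hodd : ∀ k : ℕ, φ ((e + y) ^ (2 * k + 1)) = 0) : p ≤ (φ (y ^ 2)).re := by
  have hf : IsSelfAdjoint (e + y) := he.isSelfAdjoint.add hy
  have hs0 : 2 * p - 1 ≠ 0 := fun h0 => hp2 (by linarith)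
  have hm : φ y = ((-p : ℝ) : ℂ) := by
    have := hodd 0
    rw [mul_zero, zero_add, pow_one, map_add, hp] at this
    push_cast
    linear_combination this
  have hV0 : 0 ≤ (φ (y ^ 2)).re - p ^ 2 := by
    have := h.norm_map_star_mul_sq_le 1 y
    rw [star_one, one_mul, one_mul, h.map_one, hm, hy.star_eq, ← pow_two y] at this
    simp at this
    linarith
  obtain ⟨hp0, hp1⟩ := hp01
  -- For `p ∈ {0, 1}` one has `p = p²`, and nonnegativity of the variance suffices.
  by_cases hs1 : p * (1 - p) = 0
  · nlinarith
  have hs1 : (2 * p - 1) ^ 2 < 1 := by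
    have : 0 < p * (1 - p) := lt_of_le_of_ne (by nlinarith) (Ne.symm hs1)
    nlinarith
  obtain ⟨g, hg⟩ : ∃ g : ℝ → ℝ, ∀ t : ℝ, g t = -(φ (resolvent (e + y) (Complex.I * t))).im :=
    ⟨_, fun _ => rfl⟩
  have gan : ∀ t, 0 < t → AnalyticAt ℝ g t := fun t ht => by
    rw [show g = _ from funext hg]
    exact hf.analyticAt_neg_im_resolvent φ ht
  have glow : ∀ t, 0 < t → t ≤ (t ^ 2 + (φ ((e + y) ^ 2)).re) * g t := fun t ht => by
    rw [hg]; exact h.le_mul_neg_im_resolvent hf ht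
  have hm2 : 0 ≤ (φ ((e + y) ^ 2)).re := by
    have := h.re_nonneg (e + y)
    rwa [hf.star_eq, ← pow_two] at this
  have gpos : ∀ t, 0 < t → 0 < g t := fun t ht => by
    have h1 := glow t ht
    exact pos_of_mul_pos_right (ht.trans_le h1) (by positivity)
  have gup : ∀ t, 0 < t → t * g t ≤ 1 := fun t ht => by
    have := gpos t ht
    rw [hg] at this ⊢
    exact h.mul_neg_im_resolvent_le_one hf ht this
  have wan : ∀ t, 0 < t → AnalyticAt ℝ (fun t => -Complex.I * (g t : ℂ)) t := fun t ht =>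
    analyticAt_const.mul ((Complex.ofRealCLM.analyticAt _).comp (gan t ht))
  have San : ∀ t, 0 < t →
      AnalyticAt ℝ (fun t => projSqrt (2 * p - 1) (-Complex.I * g t)) t := fun t ht =>
    AnalyticAt.comp (f := fun t : ℝ => -Complex.I * (g t : ℂ))
      (analyticAt_projSqrt (mem_slitPlane_of_imaginary hs0 (gpos t ht))).restrictScalars (wan t ht)
  have hw0 : ∀ t, 0 < t → -Complex.I * (g t : ℂ) ≠ 0 := fun t ht =>
    mul_ne_zero (neg_ne_zero.2 Complex.I_ne_zero) (by exact_mod_cast (gpos t ht).ne')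
  have ωan : ∀ t, 0 < t → AnalyticAt ℝ (fun t : ℝ => projSubordination (2 * p - 1)
      (Complex.I * t) (-Complex.I * g t)) t := fun t ht => by
    have hI : AnalyticAt ℝ (fun t : ℝ => Complex.I * (t : ℂ)) t :=
      analyticAt_const.mul (Complex.ofRealCLM.analyticAt t)
    exact (hI.add ((wan t ht).inv (hw0 t ht))).sub ((((wan t ht).add analyticAt_const).add
      (San t ht)).div (analyticAt_const.mul (wan t ht)) (mul_ne_zero two_ne_zero (hw0 t ht)))
  have hA := fun t (ht : 0 < t) => projSqrt_imaginary hs0 (gpos t ht)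
  have hb2 : ∀ t, 0 < t →
      0 < t + (1 - (projSqrt (2 * p - 1) (-Complex.I * g t)).re) / (2 * g t) := fun t ht => by
    have h1 := gpos t ht
    have h2 := (sqrt_re_bounds hs1 h1 (hA t ht).1 (hA t ht).2.2).1
    have : 0 < (1 - (projSqrt (2 * p - 1) (-Complex.I * g t)).re) / (2 * g t) :=
      div_pos (by linarith) (by linarith)
    linarith
  have hωim : ∀ t : ℝ, 0 < t → (projSubordination (2 * p - 1) (Complex.I * t)
      (-Complex.I * g t)).im ≠ 0 := fun t ht => by
    rw [projSubordination_im _ _ (gpos t ht)]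
    exact (hb2 t ht).ne'
  -- Known for large `t`; the identity theorem on `(0, ∞)` extends it, as `Im ω₂ ≠ 0` keeps the
  -- resolvent of `y` analytic along the path.
  have hG : ∀ t : ℝ, 0 < t → φ (resolvent y (projSubordination (2 * p - 1) (Complex.I * t)
      (-Complex.I * g t))) = -Complex.I * g t := by
    have hlarge := hfree.eventually_map_resolvent_projSubordination h he hy hp hs0 hodd hg gpos
    obtain ⟨T, hT⟩ := eventually_atTop.1 hlarge
    have han : AnalyticOnNhd ℝ (fun t : ℝ => φ (resolvent y (projSubordination (2 * p - 1)
        (Complex.I * t) (-Complex.I * g t)))) (Ioi 0) := fun t ht =>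
      AnalyticAt.comp (f := fun t : ℝ => projSubordination (2 * p - 1)
        (Complex.I * t) (-Complex.I * g t))
        (hy.analyticAt_map_resolvent φ (hωim t ht)).restrictScalars (ωan t ht)
    have hmem : max T 0 + 1 ∈ Ioi (0 : ℝ) := by
      have := le_max_right T 0
      exact mem_Ioi.2 (by linarith)
    refine fun t ht => han.eqOn_of_preconnected_of_eventuallyEq (fun t ht => wan t ht)
      isPreconnected_Ioi hmem ?_ ht
    filter_upwards [lt_mem_nhds (show T < max T 0 + 1 by linarith [le_max_left T 0])] with t ht
      using hT t ht.le
  have hcont : ContinuousOn (fun t => (projSqrt (2 * p - 1) (-Complex.I * g t)).re) (Ioi 0) :=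
    fun t ht => (Complex.continuous_re.continuousAt.comp
      (San t ht).continuousAt).continuousWithinAt
  have hfinal := variance_lower_bound (V := (φ (y ^ 2)).re - p ^ 2) hs0 hs1 hV0
    (fun t ht => (gan t ht).continuousAt.continuousWithinAt) hcont gpos (fun t ht => (hA t ht).1)
    glow gup (fun t ht => (hA t ht).2.2) ?_
  · have : (1 - (2 * p - 1) ^ 2) / 4 = p - p ^ 2 := by ring
    linarith
  intro t ht
  have hcs := h.normSq_one_sub_mul_le hy hm (hωim t ht)
  rw [hG t ht, projSubordination_im _ _ (gpos t ht)] at hcs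
  have hre := projSubordination_re hs0 t (gpos t ht)
  have him := projSubordination_im (2 * p - 1) t (gpos t ht)
  have hb := hb2 t ht
  have hgt := gpos t ht
  have hx : (1 + (projSqrt (2 * p - 1) (-Complex.I * g t)).re) / (2 * g t) - t = 1 / g t -
      (t + (1 - (projSqrt (2 * p - 1) (-Complex.I * g t)).re) / (2 * g t)) := by
    field_simp; ring
  rw [hx, ← hre]
  set ω := projSubordination (2 * p - 1) (Complex.I * t) (-Complex.I * g t)
  rw [← him] at hb hcs ⊢
  have hn1 : ‖1 - (ω - ((-p : ℝ) : ℂ)) * (-Complex.I * g t)‖ ^ 2 =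
      (1 - g t * ω.im) ^ 2 + (g t * (ω.re + p)) ^ 2 := by
    rw [← Complex.normSq_eq_norm_sq, Complex.normSq_apply]
    simp
    ring
  have hn2 : ‖-Complex.I * (g t : ℂ)‖ ^ 2 = g t ^ 2 := by simp
  have hn3 : (-Complex.I * (g t : ℂ)).im = -g t := by simp
  rw [hn1, hn2, hn3, neg_neg, neg_sq] at hcs
  -- Scaling by `Im ω₂ / g²` brings Cauchy–Schwarz into the form `Im ω₂ (d² + x₁²) ≤ V x₁`.
  have hmul := mul_le_mul_of_nonneg_left hcs (show 0 ≤ ω.im / g t ^ 2 by positivity)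
  have l1 : ω.im / g t ^ 2 * ((1 - g t * ω.im) ^ 2 + (g t * (ω.re + p)) ^ 2) =
      ω.im * ((ω.re + (1 + (2 * p - 1)) / 2) ^ 2 + (1 / g t - ω.im) ^ 2) := by
    field_simp
    ring
  have l2 : ω.im / g t ^ 2 * (((φ (y ^ 2)).re - p ^ 2) * (g t / ω.im - g t ^ 2)) =
      ((φ (y ^ 2)).re - p ^ 2) * (1 / g t - ω.im) := by
    field_simp
  rwa [l1, l2] at hmul

end

/-! ### Von Neumann algebras and vector states -/

section VonNeumann

variable {H : Type*} [NormedAddCommGroup H] [InnerProductSpace ℂ H] [CompleteSpace H]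

lemma VonNeumannAlgebra.isClosed_coe (M : VonNeumannAlgebra H) :
    IsClosed (M.toStarSubalgebra : Set (H →L[ℂ] H)) := by
  rw [VonNeumannAlgebra.coe_toStarSubalgebra, ← M.centralizer_centralizer]
  exact Set.isClosed_centralizer _

lemma IsNormalFunctional.exists_bound {M : VonNeumannAlgebra H}
    {φ : M.toStarSubalgebra →ₗ[ℂ] ℂ} (h : IsNormalFunctional M φ) :
    ∃ C : ℝ, ∀ a, ‖φ a‖ ≤ C * ‖a‖ := by
  obtain ⟨ξ, η, hξ, hη, hφ⟩ := h
  refine ⟨∑' n, (‖ξ n‖ ^ 2 + ‖η n‖ ^ 2), fun a => ?_⟩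
  refine (hφ a).norm_le_of_bounded ((hξ.add hη).hasSum.mul_right ‖a‖) fun n => ?_
  calc ‖inner ℂ (ξ n) ((a : H →L[ℂ] H) (η n))‖ ≤ ‖ξ n‖ * ‖(a : H →L[ℂ] H) (η n)‖ :=
        norm_inner_le_norm _ _
    _ ≤ ‖ξ n‖ * (‖(a : H →L[ℂ] H)‖ * ‖η n‖) := by
        gcongr; exact ContinuousLinearMap.le_opNorm _ _
    _ = ‖ξ n‖ * ‖η n‖ * ‖a‖ := by rw [AddSubgroupClass.coe_norm]; ring
    _ ≤ (‖ξ n‖ ^ 2 + ‖η n‖ ^ 2) * ‖a‖ := by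
        gcongr
        nlinarith [sq_nonneg (‖ξ n‖ - ‖η n‖), sq_nonneg ‖ξ n‖, sq_nonneg ‖η n‖]

/-- In a tracial `W*`-probability space, `p` is the least second moment of a free symmetrizer of
a projection of trace `p ≠ 1/2`, as soon as it contains a free copy of `-e`. -/
theorem free_symmetrization_min {p : ℝ} (hp : p ∈ Set.Icc (0 : ℝ) 1) (hp_half : p ≠ 1 / 2)
    (M : VonNeumannAlgebra H) (φ : M.toStarSubalgebra →ₗ[ℂ] ℂ) (hφ : IsNormalTracialState M φ)
    (e : M.toStarSubalgebra) (he : IsStarProjection e) (hpe : φ e = (p : ℂ)) :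
    (∀ y ∈ freeSymmetrizers φ e, p ≤ (φ (y ^ 2)).re) ∧
    (∀ y, IsSelfAdjoint y → FreelyIndependent φ e y → SameDistribution φ y (-e) →
      y ∈ freeSymmetrizers φ e ∧ φ (y ^ 2) = (p : ℂ) ∧
      IsLeast ((fun x => (φ (x ^ 2)).re) '' freeSymmetrizers φ e) p) := by
  -- Closedness makes `M` a C*-algebra, and normality makes `φ` continuous; the rest is
  -- C*-algebraic.
  have := M.isClosed_coe
  obtain ⟨C, hC⟩ := hφ.normal.exists_bound
  set Φ : M.toStarSubalgebra →L[ℂ] ℂ := φ.mkContinuous C hC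
  have hst : IsStateFunctional Φ := ⟨hφ.map_one, hφ.re_nonneg, hφ.im_eq_zero⟩
  have hlow : ∀ y ∈ freeSymmetrizers φ e, p ≤ (φ (y ^ 2)).re := fun y hy =>
    FreelyIndependent.le_map_sq_of_symmetric hst he hy.1 hp hpe hp_half
      (show FreelyIndependent (Φ : M.toStarSubalgebra →ₗ[ℂ] ℂ) e y from hy.2.1) hy.2.2
  refine ⟨hlow, fun y hy hfree hd => ?_⟩
  have hmem : y ∈ freeSymmetrizers φ e :=
    ⟨hy, hfree, fun k => FreelyIndependent.map_odd_pow_add hst.map_one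
      (show FreelyIndependent (Φ : M.toStarSubalgebra →ₗ[ℂ] ℂ) e y from hfree) hd k⟩
  have h2 : φ (y ^ 2) = (p : ℂ) := by
    rw [hd 2, neg_sq, pow_two, he.isIdempotentElem.eq, hpe]
  refine ⟨hmem, h2, ⟨y, hmem, by simp [h2]⟩, ?_⟩
  rintro _ ⟨x, hx, rfl⟩
  exact hlow x hx

/-- The commutant of the star-closure of a set of operators. -/
noncomputable def commutantOf (s : Set (H →L[ℂ] H)) : VonNeumannAlgebra H where
  toStarSubalgebra := StarSubalgebra.centralizer ℂ s
  centralizer_centralizer' := Set.centralizer_centralizer_centralizer _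

lemma mem_commutantOf {s : Set (H →L[ℂ] H)} (hs : ∀ x ∈ s, IsSelfAdjoint x) {a : H →L[ℂ] H} :
    a ∈ (commutantOf s).toStarSubalgebra ↔ ∀ x ∈ s, x * a = a * x := by
  refine (StarSubalgebra.mem_centralizer_iff ℂ).trans ⟨fun h x hx => (h x hx).1, fun h x hx =>
    ⟨h x hx, ?_⟩⟩
  rw [(hs x hx).star_eq]
  exact h x hx

/-- The vector functional `a ↦ ⟪ξ, a ξ⟫`. -/
noncomputable def vectorFunctional (M : VonNeumannAlgebra H) (ξ : H) :
    M.toStarSubalgebra →ₗ[ℂ] ℂ where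
  toFun a := inner ℂ ξ ((a : H →L[ℂ] H) ξ)
  map_add' a b := by simp
  map_smul' c a := by simp

lemma vectorFunctional_apply (M : VonNeumannAlgebra H) (ξ : H) (a : M.toStarSubalgebra) :
    vectorFunctional M ξ a = inner ℂ ξ ((a : H →L[ℂ] H) ξ) := rfl

lemma vectorFunctional_star_mul_self (M : VonNeumannAlgebra H) (ξ : H) (a : M.toStarSubalgebra) :
    vectorFunctional M ξ (star a * a) = ((‖(a : H →L[ℂ] H) ξ‖ ^ 2 : ℝ) : ℂ) := by
  rw [vectorFunctional_apply]
  have : ((star a * a : M.toStarSubalgebra) : H →L[ℂ] H) =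
      ContinuousLinearMap.adjoint (a : H →L[ℂ] H) * (a : H →L[ℂ] H) := rfl
  rw [this, mul_apply_eq_comp, ContinuousLinearMap.adjoint_inner_right,
    inner_self_eq_norm_sq_to_K]
  simp

lemma isNormalFunctional_vectorFunctional (M : VonNeumannAlgebra H) (ξ : H) :
    IsNormalFunctional M (vectorFunctional M ξ) := by
  have hs : Summable fun n : ℕ => ‖(if n = 0 then ξ else 0 : H)‖ ^ 2 :=
    summable_of_ne_finset_zero (s := {0}) fun n hn => by simp_all
  refine ⟨fun n => if n = 0 then ξ else 0, fun n => if n = 0 then ξ else 0, hs, hs, fun a => ?_⟩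
  convert hasSum_ite_eq (0 : ℕ) (vectorFunctional M ξ a) using 2 with n
  by_cases hn : n = 0 <;> simp [hn, vectorFunctional_apply]

lemma isNormalTracialState_vectorFunctional {M : VonNeumannAlgebra H} {ξ : H} (hξ : ‖ξ‖ = 1)
    (htr : ∀ a b, vectorFunctional M ξ (a * b) = vectorFunctional M ξ (b * a)) :
    IsNormalTracialState M (vectorFunctional M ξ) where
  map_one := by
    have : vectorFunctional M ξ 1 = inner ℂ ξ ξ := rfl
    rw [this, inner_self_eq_norm_sq_to_K, hξ]; simp
  re_nonneg a := by
    rw [vectorFunctional_star_mul_self, Complex.ofReal_re]; positivity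
  im_eq_zero a := by rw [vectorFunctional_star_mul_self, Complex.ofReal_im]
  tracial := htr
  normal := isNormalFunctional_vectorFunctional M ξ

lemma isFaithful_vectorFunctional {M : VonNeumannAlgebra H} {ξ : H}
    (h : ∀ a : M.toStarSubalgebra, (a : H →L[ℂ] H) ξ = 0 → a = 0) :
    IsFaithfulFunctional (vectorFunctional M ξ) := by
  intro a ha
  rw [vectorFunctional_star_mul_self] at ha
  apply h
  simpa using ha

end VonNeumann

/-- The span of `1` and `a` is closed under products and star. Consequently centred elements of the
algebra of a projection form a line, which makes freeness easy to test. -/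
lemma mem_adjoin_of_mul_self {A : Type*} [Ring A] [StarRing A] [Algebra ℂ A] [StarModule ℂ A]
    {a x : A} (ha : IsSelfAdjoint a) {v : ℂ} (hv : a * a = v • a)
    (hx : x ∈ StarAlgebra.adjoin ℂ {a}) : ∃ α β : ℂ, x = α • 1 + β • a := by
  induction hx using StarAlgebra.adjoin_induction with
  | mem x hx => exact ⟨0, 1, by simp [mem_singleton_iff.1 hx]⟩
  | algebraMap r => exact ⟨r, 0, by simp [Algebra.algebraMap_eq_smul_one]⟩
  | add x y _ _ hx hy =>
    obtain ⟨α, β, rfl⟩ := hx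
    obtain ⟨γ, δ, rfl⟩ := hy
    exact ⟨α + γ, β + δ, by module⟩
  | mul x y _ _ hx hy =>
    obtain ⟨α, β, rfl⟩ := hx
    obtain ⟨γ, δ, rfl⟩ := hy
    refine ⟨α * γ, α * δ + β * γ + β * δ * v, ?_⟩
    simp only [add_mul, mul_add, smul_mul_smul_comm, one_mul, mul_one, hv]
    module
  | star x _ hx =>
    obtain ⟨α, β, rfl⟩ := hx
    exact ⟨star α, star β, by simp [ha.star_eq]⟩

/-! ### The scalar model -/

section Scalar

/-- On `ℂ`, the vector functional is multiplicative. -/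
lemma vectorFunctional_one_mul (M : VonNeumannAlgebra ℂ) (a b : M.toStarSubalgebra) :
    vectorFunctional M 1 (a * b) = vectorFunctional M 1 a * vectorFunctional M 1 b := by
  have h : ∀ (a : ℂ →L[ℂ] ℂ) (z : ℂ), a z = z * a 1 := fun a z => by
    rw [← smul_eq_mul, ← map_smul, smul_eq_mul, mul_one]
  simp only [vectorFunctional_apply, MulMemClass.coe_mul, mul_apply_eq_comp]
  rw [h a (_)]
  simp [mul_comm]

/-- The model for `p ∈ {0, 1}`. -/
theorem exists_free_projections_of_sq_eq {p : ℝ} (hp : p * p = p) :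
    ∃ (M : VonNeumannAlgebra ℂ) (φ : M.toStarSubalgebra →ₗ[ℂ] ℂ) (e y : M.toStarSubalgebra),
      IsNormalTracialState M φ ∧ IsFaithfulFunctional φ ∧
      IsStarProjection e ∧ φ e = (p : ℂ) ∧ IsSelfAdjoint y ∧ FreelyIndependent φ e y ∧
      SameDistribution φ y (-e) := by
  have hone : IsNormalTracialState (commutantOf (∅ : Set (ℂ →L[ℂ] ℂ)))
      (vectorFunctional (commutantOf ∅) (1 : ℂ)) :=
    isNormalTracialState_vectorFunctional (by simp) fun a b => by
      rw [vectorFunctional_one_mul, vectorFunctional_one_mul, mul_comm]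
  have hpp : (p : ℂ) * p = p := by exact_mod_cast hp
  have hproj : IsStarProjection
      ((p : ℂ) • (1 : (commutantOf (∅ : Set (ℂ →L[ℂ] ℂ))).toStarSubalgebra)) := by
    refine ⟨?_, ?_⟩
    · rw [IsIdempotentElem, smul_mul_smul_comm, hpp, one_mul]
    · rw [isSelfAdjoint_iff, star_smul, star_one]; simp
  refine ⟨commutantOf ∅, vectorFunctional _ 1, (p : ℂ) • 1, -((p : ℂ) • 1), hone, ?_, hproj, ?_,
    hproj.isSelfAdjoint.neg, ?_, fun n => rfl⟩
  · refine isFaithful_vectorFunctional fun a ha => ?_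
    ext
    simpa using ha
  · rw [map_smul, hone.map_one, smul_eq_mul, mul_one]
  · intro n i a _ _ h0
    rw [List.ofFn_succ, List.prod_cons, vectorFunctional_one_mul, h0 0, zero_mul]

end Scalar

/-! ### The Hecke algebra of the infinite dihedral group on `ℓ²(ℤ)` -/

section Hecke

/-- The Hilbert space `ℓ²(ℤ)`; the integer `n` stands for the alternating word of length `|n|`
in the two generators of the infinite dihedral group, starting with the first generator if
`0 < n` and with the second one if `n < 0`. -/
abbrev EllTwo : Type := lp (fun _ : ℤ => ℂ) 2

/-- The standard basis vectors of `ℓ²(ℤ)`. -/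
noncomputable def stdVec (n : ℤ) : EllTwo := lp.single 2 n (1 : ℂ)

lemma stdVec_apply (n m : ℤ) : (stdVec n : ℤ → ℂ) m = if m = n then 1 else 0 := by
  rw [stdVec, lp.single_apply, Pi.single_apply]

lemma inner_stdVec_left (n : ℤ) (f : EllTwo) : inner ℂ (stdVec n) f = f n := by
  rw [stdVec, lp.inner_single_left]
  simp

lemma norm_stdVec (n : ℤ) : ‖stdVec n‖ = 1 := by
  rw [stdVec, lp.norm_single (by norm_num)]
  simp

lemma memℓp_comp_perm (σ : Equiv.Perm ℤ) (f : EllTwo) :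
    Memℓp (fun n => (f : ℤ → ℂ) (σ n)) 2 := by
  have h := (lp.memℓp f).summable (by norm_num)
  exact memℓp_gen ((Equiv.summable_iff σ (f := fun i => ‖f i‖ ^ (2 : ENNReal).toReal)).2 h)

open Classical in
lemma memℓp_indicator (D : Set ℤ) (f : EllTwo) :
    Memℓp (fun n => if n ∈ D then (f : ℤ → ℂ) n else 0) 2 := by
  refine (lp.memℓp f).mono' fun n => ?_
  split_ifs <;> simp

/-- Composition with a permutation of the index set. -/
noncomputable def permOp (σ : Equiv.Perm ℤ) : EllTwo →L[ℂ] EllTwo :=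
  LinearMap.mkContinuous
    { toFun := fun f => ⟨fun n => f (σ n), memℓp_comp_perm σ f⟩
      map_add' := fun f g => rfl
      map_smul' := fun c f => rfl } 1 (by
    intro f
    rw [one_mul]
    refine le_of_eq ?_
    rw [lp.norm_eq_tsum_rpow (by norm_num), lp.norm_eq_tsum_rpow (by norm_num)]
    congr 1
    exact Equiv.tsum_eq σ (fun i => ‖f i‖ ^ (2 : ENNReal).toReal))

open Classical in
/-- The coordinate projection onto a set of indices. -/
noncomputable def coordProj (D : Set ℤ) : EllTwo →L[ℂ] EllTwo :=
  LinearMap.mkContinuous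
    { toFun := fun f => ⟨fun n => if n ∈ D then f n else 0, memℓp_indicator D f⟩
      map_add' := fun f g => by
        ext n
        change (if n ∈ D then f n + g n else 0) =
          (if n ∈ D then f n else 0) + (if n ∈ D then g n else 0)
        split_ifs <;> simp
      map_smul' := fun c f => by
        ext n
        by_cases h : n ∈ D <;> simp [h] } 1 (by
    intro f
    rw [one_mul]
    refine lp.norm_mono (by norm_num) fun n => ?_
    by_cases h : n ∈ D <;> simp [h])

/-- The generator of a Hecke algebra attached to an involution `σ` with descent set `D`. -/
noncomputable def heckeOp (σ : Equiv.Perm ℤ) (D : Set ℤ) (c : ℝ) : EllTwo →L[ℂ] EllTwo :=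
  permOp σ + (c : ℂ) • coordProj D

open Classical in
lemma heckeOp_apply (σ : Equiv.Perm ℤ) (D : Set ℤ) (c : ℝ) (f : EllTwo) (n : ℤ) :
    (heckeOp σ D c f : ℤ → ℂ) n = f (σ n) + c * (if n ∈ D then f n else 0) := rfl

/-- The diagonal term is only felt on descents, so a generator that lengthens a word sends basis
vector to basis vector. -/
lemma heckeOp_stdVec {σ : Equiv.Perm ℤ} (hσ : ∀ n, σ (σ n) = n) {D : Set ℤ} (c : ℝ) {m : ℤ}
    (hm : m ∉ D) : heckeOp σ D c (stdVec m) = stdVec (σ m) := by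
  classical
  ext n
  rw [heckeOp_apply, stdVec_apply, stdVec_apply, stdVec_apply]
  have h1 : σ n = m ↔ n = σ m := ⟨fun h => by rw [← h, hσ], fun h => by rw [h, hσ]⟩
  by_cases h : n = m
  · subst h
    simp [hm, h1]
  · simp [h, h1]

lemma isSelfAdjoint_heckeOp {σ : Equiv.Perm ℤ} (hσ : ∀ n, σ (σ n) = n) (D : Set ℤ) (c : ℝ) :
    IsSelfAdjoint (heckeOp σ D c) := by
  classical
  have h1 : IsSelfAdjoint (permOp σ) := by
    rw [ContinuousLinearMap.isSelfAdjoint_iff_isSymmetric]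
    intro f g
    change inner ℂ (permOp σ f) g = inner ℂ f (permOp σ g)
    rw [lp.inner_eq_tsum, lp.inner_eq_tsum, ← Equiv.tsum_eq σ]
    refine tsum_congr fun n => ?_
    change inner ℂ (f (σ (σ n))) (g (σ n)) = inner ℂ (f n) (g (σ n))
    rw [hσ]
  have h2 : IsSelfAdjoint (coordProj D) := by
    rw [ContinuousLinearMap.isSelfAdjoint_iff_isSymmetric]
    intro f g
    change inner ℂ (coordProj D f) g = inner ℂ f (coordProj D g)
    rw [lp.inner_eq_tsum, lp.inner_eq_tsum]
    refine tsum_congr fun n => ?_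
    change inner ℂ (if n ∈ D then f n else 0) (g n) = inner ℂ (f n) (if n ∈ D then g n else 0)
    split_ifs <;> simp
  refine h1.add (IsSelfAdjoint.smul ?_ h2)
  simp [isSelfAdjoint_iff]

/-- `σ` exchanges `D` with its complement, so exactly one of `n`, `σ n` is a descent; this yields
the quadratic Hecke relation. -/
lemma heckeOp_mul_self {σ : Equiv.Perm ℤ} (hσ : ∀ n, σ (σ n) = n) {D : Set ℤ}
    (hD : ∀ n, σ n ∈ D ↔ n ∉ D) (c : ℝ) :
    heckeOp σ D c * heckeOp σ D c = 1 + (c : ℂ) • heckeOp σ D c := by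
  classical
  ext f n
  change (heckeOp σ D c (heckeOp σ D c f) : ℤ → ℂ) n = f n + c * (heckeOp σ D c f : ℤ → ℂ) n
  simp only [heckeOp_apply, hσ, hD]
  by_cases h : n ∈ D <;> simp [h]

/-- The alternative is the Coxeter exchange dichotomy for a left and a right multiplication: either
they agree on the word, or neither affects the descents of the other. -/
lemma heckeOp_commute {σ ρ : Equiv.Perm ℤ} {D E : Set ℤ} (hσρ : ∀ n, σ (ρ n) = ρ (σ n))
    (h : ∀ n, (σ n = ρ n ∧ (σ n ∈ E ↔ ρ n ∈ D) ∧ (n ∈ D ↔ n ∈ E)) ∨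
      ((σ n ∈ E ↔ n ∈ E) ∧ (ρ n ∈ D ↔ n ∈ D))) (c : ℝ) :
    heckeOp σ D c * heckeOp ρ E c = heckeOp ρ E c * heckeOp σ D c := by
  classical
  ext f n
  change (heckeOp σ D c (heckeOp ρ E c f) : ℤ → ℂ) n = (heckeOp ρ E c (heckeOp σ D c f) : ℤ → ℂ) n
  simp only [heckeOp_apply, hσρ]
  rcases h n with ⟨h1, h2, h3⟩ | ⟨h1, h2⟩
  · simp only [h2, h3]
    rw [h1]
  · simp only [h1, h2]
    by_cases h4 : n ∈ E <;> by_cases h5 : n ∈ D <;> simp [h4, h5] <;> ring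

/-- Left multiplication by the two generators, on words. -/
def leftPerm : Fin 2 → Equiv.Perm ℤ := ![Equiv.subLeft 1, Equiv.subLeft (-1)]

/-- Words that become shorter under left multiplication by a generator. -/
def leftDescent : Fin 2 → Set ℤ := ![{n | 1 ≤ n}, {n | n ≤ -1}]

/-- Right multiplication by the two generators, on words. -/
def rightPerm : Fin 2 → Equiv.Perm ℤ :=
  ![Function.Involutive.toPerm (fun n : ℤ => if n % 2 = 0 then n + 1 else n - 1) (fun n => by
      dsimp only; split_ifs <;> omega),
    Function.Involutive.toPerm (fun n : ℤ => if n % 2 = 0 then n - 1 else n + 1) (fun n => by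
      dsimp only; split_ifs <;> omega)]

/-- Words that become shorter under right multiplication by a generator. -/
def rightDescent : Fin 2 → Set ℤ :=
  ![{n | n % 2 ≠ 0 ∧ 0 < n ∨ n % 2 = 0 ∧ n < 0}, {n | n % 2 = 0 ∧ 0 < n ∨ n % 2 ≠ 0 ∧ n < 0}]

lemma leftPerm_zero_apply (n : ℤ) : leftPerm 0 n = 1 - n := rfl
lemma leftPerm_one_apply (n : ℤ) : leftPerm 1 n = -1 - n := rfl
lemma rightPerm_zero_apply (n : ℤ) : rightPerm 0 n = if n % 2 = 0 then n + 1 else n - 1 := rfl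
lemma rightPerm_one_apply (n : ℤ) : rightPerm 1 n = if n % 2 = 0 then n - 1 else n + 1 := rfl
lemma mem_leftDescent_zero {n : ℤ} : n ∈ leftDescent 0 ↔ 1 ≤ n := Iff.rfl
lemma mem_leftDescent_one {n : ℤ} : n ∈ leftDescent 1 ↔ n ≤ -1 := Iff.rfl
lemma mem_rightDescent_zero {n : ℤ} :
    n ∈ rightDescent 0 ↔ n % 2 ≠ 0 ∧ 0 < n ∨ n % 2 = 0 ∧ n < 0 := Iff.rfl
lemma mem_rightDescent_one {n : ℤ} :
    n ∈ rightDescent 1 ↔ n % 2 = 0 ∧ 0 < n ∨ n % 2 ≠ 0 ∧ n < 0 := Iff.rfl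

lemma leftPerm_involutive (i : Fin 2) (n : ℤ) : leftPerm i (leftPerm i n) = n := by
  fin_cases i
  · change 1 - (1 - n) = n; ring
  · change -1 - (-1 - n) = n; ring

lemma rightPerm_involutive (i : Fin 2) (n : ℤ) : rightPerm i (rightPerm i n) = n := by
  fin_cases i
  · change rightPerm 0 (rightPerm 0 n) = n
    simp only [rightPerm_zero_apply]; split_ifs <;> omega
  · change rightPerm 1 (rightPerm 1 n) = n
    simp only [rightPerm_one_apply]; split_ifs <;> omega

lemma leftPerm_mem_leftDescent (i : Fin 2) (n : ℤ) :
    leftPerm i n ∈ leftDescent i ↔ n ∉ leftDescent i := by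
  fin_cases i
  · change 1 ≤ 1 - n ↔ ¬ 1 ≤ n; omega
  · change -1 - n ≤ -1 ↔ ¬ n ≤ -1; omega

/-- The generators acting from the left. -/
noncomputable def leftOp (c : ℝ) (i : Fin 2) : EllTwo →L[ℂ] EllTwo :=
  heckeOp (leftPerm i) (leftDescent i) c

/-- The generators acting from the right. -/
noncomputable def rightOp (c : ℝ) (i : Fin 2) : EllTwo →L[ℂ] EllTwo :=
  heckeOp (rightPerm i) (rightDescent i) c

lemma leftOp_mul_rightOp (c : ℝ) (i j : Fin 2) :
    leftOp c i * rightOp c j = rightOp c j * leftOp c i := by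
  refine heckeOp_commute (fun n => ?_) (fun n => ?_) c
  all_goals
    fin_cases i <;> fin_cases j <;>
    simp only [Fin.zero_eta, Fin.mk_one, Fin.isValue, leftPerm_zero_apply, leftPerm_one_apply,
      rightPerm_zero_apply, rightPerm_one_apply, mem_leftDescent_zero, mem_leftDescent_one,
      mem_rightDescent_zero, mem_rightDescent_one]
  all_goals split_ifs <;> omega

lemma leftOp_zero_stdVec (c : ℝ) {n : ℤ} (hn : n ≤ 0) :
    leftOp c 0 (stdVec n) = stdVec (1 - n) :=
  heckeOp_stdVec (leftPerm_involutive 0) c (by rw [mem_leftDescent_zero]; omega)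

lemma leftOp_one_stdVec (c : ℝ) {n : ℤ} (hn : 0 ≤ n) :
    leftOp c 1 (stdVec n) = stdVec (-1 - n) :=
  heckeOp_stdVec (leftPerm_involutive 1) c (by rw [mem_leftDescent_one]; omega)

lemma rightOp_zero_stdVec (c : ℝ) {n : ℤ} (h : n % 2 = 0 ∧ 0 ≤ n ∨ n % 2 ≠ 0 ∧ n ≤ 0) :
    rightOp c 0 (stdVec n) = stdVec (if n % 2 = 0 then n + 1 else n - 1) :=
  heckeOp_stdVec (rightPerm_involutive 0) c (by rw [mem_rightDescent_zero]; omega)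

lemma rightOp_one_stdVec (c : ℝ) {n : ℤ} (h : n % 2 = 0 ∧ n ≤ 0 ∨ n % 2 ≠ 0 ∧ 0 ≤ n) :
    rightOp c 1 (stdVec n) = stdVec (if n % 2 = 0 then n - 1 else n + 1) :=
  heckeOp_stdVec (rightPerm_involutive 1) c (by rw [mem_rightDescent_one]; omega)

lemma isSelfAdjoint_leftOp (c : ℝ) (i : Fin 2) : IsSelfAdjoint (leftOp c i) :=
  isSelfAdjoint_heckeOp (leftPerm_involutive i) _ c

lemma isSelfAdjoint_rightOp (c : ℝ) (i : Fin 2) : IsSelfAdjoint (rightOp c i) :=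
  isSelfAdjoint_heckeOp (rightPerm_involutive i) _ c

lemma leftOp_mul_self (c : ℝ) (i : Fin 2) :
    leftOp c i * leftOp c i = 1 + (c : ℂ) • leftOp c i :=
  heckeOp_mul_self (leftPerm_involutive i) (leftPerm_mem_leftDescent i) c

lemma rightOp_one_mul_zero_pow_stdVec (c : ℝ) (k : ℕ) :
    ((rightOp c 1 * rightOp c 0) ^ k) (stdVec 0) = stdVec (2 * k) := by
  induction k with
  | zero => simp
  | succ k ih =>
    rw [pow_succ', mul_apply_eq_comp, ih, mul_apply_eq_comp, rightOp_zero_stdVec c (by omega),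
      rightOp_one_stdVec c (by split_ifs <;> omega)]
    congr 1
    push_cast
    split_ifs <;> omega

lemma rightOp_zero_mul_one_pow_stdVec (c : ℝ) (k : ℕ) :
    ((rightOp c 0 * rightOp c 1) ^ k) (stdVec 0) = stdVec (-(2 * k)) := by
  induction k with
  | zero => simp
  | succ k ih =>
    rw [pow_succ', mul_apply_eq_comp, ih, mul_apply_eq_comp, rightOp_one_stdVec c (by omega),
      rightOp_zero_stdVec c (by split_ifs <;> omega)]
    congr 1
    push_cast
    split_ifs <;> omega

/-! ### The commutant of the right action and its trace -/

/-- Inversion of words. -/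
def wordInv : Equiv.Perm ℤ :=
  Function.Involutive.toPerm (fun n : ℤ => if n % 2 = 0 then -n else n) (fun n => by
    dsimp only; split_ifs <;> omega)

lemma wordInv_apply (n : ℤ) : wordInv n = if n % 2 = 0 then -n else n := rfl

lemma wordInv_wordInv (n : ℤ) : wordInv (wordInv n) = n := by
  simp only [wordInv_apply]; split_ifs <;> omega

/-- The commutant of the right action. -/
noncomputable def heckeVN (c : ℝ) : VonNeumannAlgebra EllTwo := commutantOf (range (rightOp c))

lemma mem_heckeVN {c : ℝ} {a : EllTwo →L[ℂ] EllTwo} :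
    a ∈ (heckeVN c).toStarSubalgebra ↔ ∀ i, rightOp c i * a = a * rightOp c i := by
  rw [heckeVN, mem_commutantOf (by rintro _ ⟨i, rfl⟩; exact isSelfAdjoint_rightOp c i), forall_mem_range]

/-- Build the word letter by letter with right generators, each step lengthening it; the adjoint
reverses the order of the letters, hence inverts the word. -/
lemma exists_commuting_stdVec (c : ℝ) (n : ℤ) : ∃ X : EllTwo →L[ℂ] EllTwo,
    (∀ a ∈ (heckeVN c).toStarSubalgebra, Commute X a) ∧ X (stdVec 0) = stdVec n ∧
      (star X) (stdVec 0) = stdVec (wordInv n) := by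
  have hR : ∀ i, ∀ a ∈ (heckeVN c).toStarSubalgebra, Commute (rightOp c i) a :=
    fun i a ha => mem_heckeVN.1 ha i
  have hs := fun i => (isSelfAdjoint_rightOp c i).star_eq
  have s10 : ∀ k, star ((rightOp c 1 * rightOp c 0) ^ k) = (rightOp c 0 * rightOp c 1) ^ k :=
    fun k => by rw [star_pow, star_mul, hs, hs]
  have s01 : ∀ k, star ((rightOp c 0 * rightOp c 1) ^ k) = (rightOp c 1 * rightOp c 0) ^ k :=
    fun k => by rw [star_pow, star_mul, hs, hs]
  obtain ⟨k, hk⟩ : ∃ k : ℕ, n = 2 * k ∨ n = -(2 * k) ∨ n = 2 * k + 1 ∨ n = -(2 * k) - 1 :=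
    ⟨(n.natAbs / 2), by omega⟩
  rcases hk with rfl | rfl | rfl | rfl
  · refine ⟨(rightOp c 1 * rightOp c 0) ^ k,
      fun a ha => ((hR 1 a ha).mul_left (hR 0 a ha)).pow_left k,
      rightOp_one_mul_zero_pow_stdVec c k, ?_⟩
    rw [s10, rightOp_zero_mul_one_pow_stdVec, wordInv_apply, if_pos (by omega)]
  · refine ⟨(rightOp c 0 * rightOp c 1) ^ k,
      fun a ha => ((hR 0 a ha).mul_left (hR 1 a ha)).pow_left k,
      rightOp_zero_mul_one_pow_stdVec c k, ?_⟩
    rw [s01, rightOp_one_mul_zero_pow_stdVec, wordInv_apply, if_pos (by omega), neg_neg]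
  · have hv : (rightOp c 0 * (rightOp c 1 * rightOp c 0) ^ k) (stdVec 0) = stdVec (2 * k + 1) := by
      rw [mul_apply_eq_comp, rightOp_one_mul_zero_pow_stdVec, rightOp_zero_stdVec c (by omega),
        if_pos (by omega)]
    refine ⟨rightOp c 0 * (rightOp c 1 * rightOp c 0) ^ k,
      fun a ha => (hR 0 a ha).mul_left (((hR 1 a ha).mul_left (hR 0 a ha)).pow_left k), hv, ?_⟩
    rw [star_mul, s10, hs, mul_pow_mul, hv, wordInv_apply, if_neg (by omega)]
  · have hv : (rightOp c 1 * (rightOp c 0 * rightOp c 1) ^ k) (stdVec 0) =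
        stdVec (-(2 * k) - 1) := by
      rw [mul_apply_eq_comp, rightOp_zero_mul_one_pow_stdVec, rightOp_one_stdVec c (by omega),
        if_pos (by omega)]
    refine ⟨rightOp c 1 * (rightOp c 0 * rightOp c 1) ^ k,
      fun a ha => (hR 1 a ha).mul_left (((hR 0 a ha).mul_left (hR 1 a ha)).pow_left k), hv, ?_⟩
    rw [star_mul, s01, hs, mul_pow_mul, hv, wordInv_apply, if_neg (by omega)]

/-- `stdVec 0` is cyclic for the right action, hence separating for its commutant. -/
lemma heckeVN_separating {c : ℝ} {a : EllTwo →L[ℂ] EllTwo}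
    (ha : a ∈ (heckeVN c).toStarSubalgebra) (h0 : a (stdVec 0) = 0) : a = 0 := by
  have h1 : ∀ n, a (stdVec n) = 0 := fun n => by
    obtain ⟨X, hX, hXn, -⟩ := exists_commuting_stdVec c n
    rw [← hXn, ← mul_apply_eq_comp, ← (hX a ha).eq, mul_apply_eq_comp, h0, map_zero]
  ext f : 1
  have hs := (lp.hasSum_single (by norm_num) f).mapL a
  refine hs.unique ?_
  rw [zero_apply]
  convert (hasSum_zero : HasSum (fun _ : ℤ => (0 : EllTwo)) 0) using 2 with n
  have : lp.single 2 n (f n) = (f n) • stdVec n := by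
    rw [stdVec, ← lp.single_smul]; simp
  rw [this, map_smul, h1, smul_zero]

lemma star_apply_stdVec_zero {c : ℝ} {a : EllTwo →L[ℂ] EllTwo}
    (ha : a ∈ (heckeVN c).toStarSubalgebra) (n : ℤ) :
    (star a (stdVec 0) : ℤ → ℂ) n = star ((a (stdVec 0) : ℤ → ℂ) (wordInv n)) := by
  obtain ⟨X, hX, hXn, hXs⟩ := exists_commuting_stdVec c n
  rw [← inner_stdVec_left, ← inner_stdVec_left, ContinuousLinearMap.star_eq_adjoint,
    ContinuousLinearMap.adjoint_inner_right, ← hXn, ← mul_apply_eq_comp, ← (hX a ha).eq,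
    mul_apply_eq_comp, ← hXs, ContinuousLinearMap.star_eq_adjoint,
    ContinuousLinearMap.adjoint_inner_left, Complex.star_def, inner_conj_symm]

/-- The adjoint acts on coefficients by conjugation and word inversion, so the trace of `a * b` is a
bilinear sum that inversion makes symmetric. -/
lemma heckeVN_tracial (c : ℝ) (a b : (heckeVN c).toStarSubalgebra) :
    vectorFunctional (heckeVN c) (stdVec 0) (a * b) =
      vectorFunctional (heckeVN c) (stdVec 0) (b * a) := by
  have key : ∀ a b : (heckeVN c).toStarSubalgebra,
      vectorFunctional (heckeVN c) (stdVec 0) (a * b) =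
        ∑' n, ((a : EllTwo →L[ℂ] EllTwo) (stdVec 0) : ℤ → ℂ) (wordInv n) *
          ((b : EllTwo →L[ℂ] EllTwo) (stdVec 0) : ℤ → ℂ) n := by
    intro a b
    rw [vectorFunctional_apply, MulMemClass.coe_mul, mul_apply_eq_comp,
      ← ContinuousLinearMap.adjoint_inner_left, ← ContinuousLinearMap.star_eq_adjoint,
      lp.inner_eq_tsum]
    refine tsum_congr fun n => ?_
    rw [star_apply_stdVec_zero a.2]
    simp [mul_comm]
  rw [key, key, ← Equiv.tsum_eq wordInv]
  refine tsum_congr fun n => ?_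
  rw [wordInv_wordInv, mul_comm]

/-! ### Free projections from the generators -/

/-- Alternation means that every new letter lengthens the word, so no diagonal term appears and the
index never returns to `0`. -/
lemma prod_leftOp_stdVec (c : ℝ) (n : ℕ) (i : Fin (n + 1) → Fin 2)
    (x : Fin (n + 1) → (EllTwo →L[ℂ] EllTwo)) (hi : ∀ k : Fin n, i k.castSucc ≠ i k.succ)
    (hx : ∀ k, ∃ β : ℂ, x k = β • leftOp c (i k)) :
    ∃ γ : ℂ, (List.ofFn x).prod (stdVec 0) =
      γ • stdVec (if i 0 = 0 then (n + 1 : ℤ) else -(n + 1 : ℤ)) := by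
  induction n with
  | zero =>
    obtain ⟨β, hβ⟩ := hx 0
    refine ⟨β, ?_⟩
    rw [List.ofFn_succ, List.ofFn_zero, List.prod_cons, List.prod_nil, mul_one, hβ]
    generalize i 0 = j
    fin_cases j
    · simp [leftOp_zero_stdVec c le_rfl]
    · simp [leftOp_one_stdVec c le_rfl]
  | succ n ih =>
    obtain ⟨γ, hγ⟩ := ih (fun k => i k.succ) (fun k => x k.succ)
      (fun k => by simpa using hi k.succ) (fun k => hx k.succ)
    obtain ⟨β, hβ⟩ := hx 0
    refine ⟨γ * β, ?_⟩
    rw [List.ofFn_succ, List.prod_cons, mul_apply_eq_comp, hγ, hβ, map_smul, mul_smul]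
    congr 1
    have h01 : i 0 ≠ i (Fin.succ 0) := hi 0
    revert h01
    generalize i 0 = j
    generalize i (Fin.succ 0) = l
    intro h01
    have hj : j = 0 ∧ l = 1 ∨ j = 1 ∧ l = 0 := by
      revert j l; decide
    rcases hj with ⟨rfl, rfl⟩ | ⟨rfl, rfl⟩
    · rw [if_neg one_ne_zero, if_pos rfl, smul_apply,
        leftOp_zero_stdVec c (by omega)]
      congr 2
      push_cast
      ring
    · rw [if_neg one_ne_zero, if_pos rfl, smul_apply,
        leftOp_one_stdVec c (by omega)]
      congr 2
      push_cast
      ring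

lemma leftOp_mem_heckeVN (c : ℝ) (i : Fin 2) : leftOp c i ∈ (heckeVN c).toStarSubalgebra :=
  mem_heckeVN.2 fun j => (leftOp_mul_rightOp c i j).symm

/-- The generators as elements of the von Neumann algebra. -/
noncomputable def heckeGen (c : ℝ) (i : Fin 2) : (heckeVN c).toStarSubalgebra :=
  ⟨leftOp c i, leftOp_mem_heckeVN c i⟩

lemma heckeGen_mul_self (c : ℝ) (i : Fin 2) :
    heckeGen c i * heckeGen c i = 1 + (c : ℂ) • heckeGen c i :=
  Subtype.ext (leftOp_mul_self c i)

lemma star_heckeGen (c : ℝ) (i : Fin 2) : star (heckeGen c i) = heckeGen c i :=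
  Subtype.ext (isSelfAdjoint_leftOp c i).star_eq

/-- Alternating products of multiples of the generators have trace zero. -/
lemma vectorFunctional_prod_heckeGen (c : ℝ) (n : ℕ) (i : Fin (n + 1) → Fin 2)
    (x : Fin (n + 1) → (heckeVN c).toStarSubalgebra)
    (hi : ∀ k : Fin n, i k.castSucc ≠ i k.succ)
    (hx : ∀ k, ∃ β : ℂ, x k = β • heckeGen c (i k)) :
    vectorFunctional (heckeVN c) (stdVec 0) (List.ofFn x).prod = 0 := by
  obtain ⟨γ, hγ⟩ := prod_leftOp_stdVec c n i (fun k => (x k : EllTwo →L[ℂ] EllTwo)) hi (fun k => by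
    obtain ⟨β, hβ⟩ := hx k
    exact ⟨β, by rw [hβ]; rfl⟩)
  have hcoe : ((List.ofFn x).prod : EllTwo →L[ℂ] EllTwo) =
      (List.ofFn fun k => (x k : EllTwo →L[ℂ] EllTwo)).prod := by
    have := map_list_prod (heckeVN c).toStarSubalgebra.subtype (List.ofFn x)
    rw [List.map_ofFn] at this
    exact this
  rw [vectorFunctional_apply, hcoe, hγ, inner_stdVec_left]
  rw [lp.coeFn_smul, Pi.smul_apply, stdVec_apply, if_neg, smul_zero]
  split_ifs <;> omega

/-- The model for `0 < p < 1`, in the Hecke von Neumann algebra of the infinite dihedral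
group. -/
theorem exists_free_projections {p : ℝ} (h0 : 0 < p) (h1 : p < 1) :
    ∃ (M : VonNeumannAlgebra EllTwo) (φ : M.toStarSubalgebra →ₗ[ℂ] ℂ)
      (e y : M.toStarSubalgebra), IsNormalTracialState M φ ∧ IsFaithfulFunctional φ ∧
      IsStarProjection e ∧ φ e = (p : ℂ) ∧ IsSelfAdjoint y ∧ FreelyIndependent φ e y ∧
      SameDistribution φ y (-e) := by
  have hpq : 0 < p * (1 - p) := by nlinarith
  -- With `T² = 1 + cT`, the element `p + rT` is idempotent if `p² + r² = p` and `2p + rc = 1`.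
  obtain ⟨r, hr, hr0⟩ : ∃ r : ℝ, r * r = p * (1 - p) ∧ r ≠ 0 :=
    ⟨√(p * (1 - p)), Real.mul_self_sqrt hpq.le, (Real.sqrt_pos.2 hpq).ne'⟩
  obtain ⟨c, hc⟩ : ∃ c : ℝ, r * c = 1 - 2 * p := ⟨(1 - 2 * p) / r, by field_simp⟩
  have htr : IsNormalTracialState (heckeVN c) (vectorFunctional (heckeVN c) (stdVec 0)) :=
    isNormalTracialState_vectorFunctional (norm_stdVec 0) (heckeVN_tracial c)
  set φ := vectorFunctional (heckeVN c) (stdVec 0) with hφ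
  set q : Fin 2 → (heckeVN c).toStarSubalgebra := fun i => (p : ℂ) • 1 + (r : ℂ) • heckeGen c i
    with hq
  have hφg : ∀ i, φ (heckeGen c i) = 0 := fun i => by
    have := vectorFunctional_prod_heckeGen c 0 (fun _ => i) (fun _ => heckeGen c i)
      (fun k => k.elim0) (fun _ => ⟨1, (one_smul _ _).symm⟩)
    simpa using this
  have hφq : ∀ i, φ (q i) = p := fun i => by
    rw [hq]
    simp only [map_add, map_smul, hφg, htr.map_one, smul_eq_mul, mul_one, mul_zero, add_zero]
  have hqq : ∀ i, q i * q i = q i := fun i => by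
    have hr' : (r : ℂ) * r = p * (1 - p) := by exact_mod_cast hr
    have hc' : (r : ℂ) * c = 1 - 2 * p := by exact_mod_cast hc
    have e1 : q i * q i = ((p : ℂ) * p + r * r) • 1 + (2 * p * r + r * (r * c) : ℂ) • heckeGen c i := by
      simp only [hq, add_mul, mul_add, smul_mul_smul_comm, one_mul, mul_one, heckeGen_mul_self]
      module
    rw [e1, hr', hc', hq]
    module
  have hqs : ∀ i, IsSelfAdjoint (q i) := fun i => by
    rw [isSelfAdjoint_iff, hq]
    simp [star_heckeGen]
  have hproj : ∀ i, IsStarProjection (q i) := fun i => ⟨hqq i, hqs i⟩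
  have hpow : ∀ i n, φ ((-q i) ^ n) = if n = 0 then 1 else (-1) ^ n * (p : ℂ) := fun i n => by
    rcases n with _ | n
    · simp [htr.map_one]
    · have : (-q i) ^ (n + 1) = ((-1 : ℂ) ^ (n + 1)) • q i := by
        rw [neg_pow, (hproj i).isIdempotentElem.pow_succ_eq]
        simp [Algebra.smul_def]
      rw [this, map_smul, hφq]
      simp
  refine ⟨heckeVN c, φ, q 0, -q 1, htr, ?_, hproj 0, hφq 0, (hqs 1).neg, ?_, fun n => ?_⟩
  · exact isFaithful_vectorFunctional fun a ha => Subtype.ext (heckeVN_separating a.2 ha)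
  -- A centred element of either algebra is a multiple of the generator, so alternating products of
  -- generators decide freeness.
  · intro n i x hi hx hx0
    refine vectorFunctional_prod_heckeGen c n i x hi fun k => ?_
    have hk := hx k
    have hk0 := hx0 k
    revert hk
    generalize i k = j
    intro hk
    fin_cases j
    · obtain ⟨α, β, hαβ⟩ := mem_adjoin_of_mul_self (hqs 0) (v := 1) (by rw [hqq, one_smul]) hk
      rw [hαβ, map_add, map_smul, map_smul, hφq, htr.map_one, smul_eq_mul, smul_eq_mul,
        mul_one] at hk0
      refine ⟨β * r, ?_⟩
      rw [hαβ, eq_neg_of_add_eq_zero_left hk0, hq]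
      simp only [Fin.zero_eta]
      module
    · obtain ⟨α, β, hαβ⟩ := mem_adjoin_of_mul_self (hqs 1).neg (v := -1)
        (by rw [neg_mul_neg, hqq]; simp) hk
      rw [hαβ, map_add, map_smul, map_smul, map_neg, hφq, htr.map_one, smul_eq_mul, smul_eq_mul,
        mul_one] at hk0
      refine ⟨-β * r, ?_⟩
      rw [hαβ, eq_neg_of_add_eq_zero_left hk0, hq]
      simp only [Fin.mk_one]
      module
  · rw [hpow, hpow]

end Hecke

end FreeSymmetrization

theorem theorem2 (p : ℝ) (hp : p ∈ Set.Icc (0 : ℝ) 1) (hp_half : p ≠ 1 / 2) :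
    -- in every tracial W*-probability space, `p` is a lower bound, and it is the minimum,
    -- attained at `y`, as soon as there is a `y` free from `e` and distributed as `-e`
    (∀ (H : Type*) [NormedAddCommGroup H] [InnerProductSpace ℂ H] [CompleteSpace H]
      (M : VonNeumannAlgebra H) (φ : M.toStarSubalgebra →ₗ[ℂ] ℂ),
      IsNormalTracialState M φ →
      ∀ e : M.toStarSubalgebra, IsStarProjection e → φ e = (p : ℂ) →
        (∀ y ∈ freeSymmetrizers φ e, p ≤ (φ (y ^ 2)).re) ∧
        (∀ y, IsSelfAdjoint y → FreelyIndependent φ e y → SameDistribution φ y (-e) →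
          y ∈ freeSymmetrizers φ e ∧ φ (y ^ 2) = (p : ℂ) ∧
          IsLeast ((fun x => (φ (x ^ 2)).re) '' freeSymmetrizers φ e) p)) ∧
    -- such a `y` exists in a suitable tracial W*-probability space, so the minimum is attained
    (∃ (H : Type) (_ : NormedAddCommGroup H) (_ : InnerProductSpace ℂ H) (_ : CompleteSpace H)
      (M : VonNeumannAlgebra H) (φ : M.toStarSubalgebra →ₗ[ℂ] ℂ) (e y : M.toStarSubalgebra),
      IsNormalTracialState M φ ∧ IsFaithfulFunctional φ ∧
      IsStarProjection e ∧ φ e = (p : ℂ) ∧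
      y ∈ freeSymmetrizers φ e ∧ SameDistribution φ y (-e) ∧ φ (y ^ 2) = (p : ℂ) ∧
      IsLeast ((fun x => (φ (x ^ 2)).re) '' freeSymmetrizers φ e) p) := by
  refine ⟨fun H _ _ _ M φ hφ e he hpe => free_symmetrization_min hp hp_half M φ hφ e he hpe, ?_⟩
  -- At `p ∈ {0, 1}` the scale `r` of the Hecke model degenerates to `0`.
  by_cases h : p * p = p
  · obtain ⟨M, φ, e, y, hφ, hfaith, he, hpe, hy, hfree, hd⟩ := exists_free_projections_of_sq_eq h
    obtain ⟨h1, h2, h3⟩ := (free_symmetrization_min hp hp_half M φ hφ e he hpe).2 y hy hfree hd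
    exact ⟨ℂ, inferInstance, inferInstance, inferInstance, M, φ, e, y, hφ, hfaith, he, hpe, h1, hd,
      h2, h3⟩
  · have h0 : 0 < p := lt_of_le_of_ne hp.1 fun h0 => h (by simp [← h0])
    have h1 : p < 1 := lt_of_le_of_ne hp.2 fun h1 => h (by simp [h1])
    obtain ⟨M, φ, e, y, hφ, hfaith, he, hpe, hy, hfree, hd⟩ := exists_free_projections h0 h1
    obtain ⟨h1, h2, h3⟩ := (free_symmetrization_min hp hp_half M φ hφ e he hpe).2 y hy hfree hd
    exact ⟨EllTwo, inferInstance, inferInstance, inferInstance, M, φ, e, y, hφ, hfaith, he, hpe, h1,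
      hd, h2, h3⟩
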